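/- Let $(M,g)$ be a $7$-dimensional oriented smooth Riemannian manifold with a $G_2$-structure, that is, a global $3$-form $\varphi$ which near every point has the form $$\varphi=e^{123}+e^{145}+e^{167}+e^{246}-e^{257}-e^{347}-e^{356}$$ in the coframe dual to some smooth local oriented orthonormal frame (an adapted frame). Let $\times$ be the cross product given by $g(u\times v,w)=\varphi(u,v,w)$. Let $\nabla$ be the Levi-Civita connection and $s$ its scalar curvature. Let $\mathfrak g_2(T_xM)\subset\mathfrak{so}(T_xM)$ be the Lie algebra of the stabilizer of $\varphi_x$, and $\mathfrak g_2^\perp(T_xM)=\{w\mapsto w\times Z: Z\in T_xM\}$ its orthogonal complement in $\mathfrak{so}(T_xM)$. The intrinsic torsion $\xi$ is the $(1,2)$-tensor for which $-\xi_v$ is, for each tangent vector $v$, the $\mathfrak g_2^\perp$-component of the connection form of $\nabla$ in an adapted frame. Let $T$ be the endomorphism of $TM$ with $\xi_v w=w\times T(v)$. The characteristic vector field is $\chi=\sum_i\xi_{e_i}e_i$, for any orthonormal basis $(e_i)$. For an endomorphism $\alpha$ of $T_xM$ put $$i_0(\alpha)=\sum_{i,j}g(\alpha(e_i)\times\alpha(e_j),e_i\times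 e_j),$$ and let $\sigma_2(\alpha)$ be the second elementary symmetric function of the eigenvalues of $\alpha$, i.e. the coefficient of $\lambda^5$ in $\det(\lambda I-\alpha)$. At each point $x$ put $$\mathfrak X_1=\mathbb R\,\mathrm{Id},\quad \mathfrak X_2=\mathfrak g_2(T_xM),\quad \mathfrak X_3=S^2_0(T_xM),\quad \mathfrak X_4=\mathfrak g_2^\perp(T_xM),$$ where $S^2_0(T_xM)$ is the space of symmetric trace-free endomorphisms. (1) If the structure is of type $\mathfrak X_1\oplus\mathfrak X_2\oplus\mathfrak X_3$, i.e. $T_x\in\mathfrak X_1+\mathfrak X_2+\mathfrak X_3$ at every $x\in M$, then $\chi=0$ and, at every point of $M$, $$\tfrac16\, s=-\tfrac32\, i_0(T)+6\,\sigma_2(T).$$ (2) For an arbitrary $G_2$-structure, at each point $x$ there are unique $T_i\in\mathfrak X_i$ and a unique $Z\in T_xM$ with $T=T_1+T_2+T_3+T_4$ and $T_4(u)=u\times Z$ for all $u$. With $\chi_k=\sum_i e_i\times T_k(e_i)$ the component of $\chi$ coming from $T_k$, one has $\chi_1=\chi_2=\chi_3=0$ and $\chi=\chi_4=-6Z$.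 -/

import Mathlib

open Bundle Set FiberBundle VectorField
open scoped Manifold ContDiff Topology

set_option linter.unusedSectionVars false

namespace G2Geometry

section LeviCivita

variable {E : Type*} [NormedAddCommGroup E] [NormedSpace ℝ E]
  {H : Type*} [TopologicalSpace H] {I : ModelWithCorners ℝ E H}
  {M : Type*} [TopologicalSpace M] [ChartedSpace H M]
  [RiemannianBundle (fun x : M => TangentSpace I x)]

/-- Half the right-hand side of the Koszul formula, i.e. the expression for `g(∇_X Y, Z)` at `x`. -/
noncomputable def koszul (I : ModelWithCorners ℝ E H) {M : Type*} [TopologicalSpace M] [ChartedSpace H M]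
  [RiemannianBundle (fun x : M => TangentSpace I x)]
   (X Y Z : Π x : M, TangentSpace I x) (x : M) : ℝ :=
  (1 / 2 : ℝ) *
    (mvfderiv I (fun y => inner ℝ (Y y) (Z y)) x (X x)
      + mvfderiv I (fun y => inner ℝ (X y) (Z y)) x (Y x)
      - mvfderiv I (fun y => inner ℝ (X y) (Y y)) x (Z x)
      + inner ℝ (mlieBracket I X Y x) (Z x)
      - inner ℝ (mlieBracket I X Z x) (Y x)
      - inner ℝ (mlieBracket I Y Z x) (X x))

variable [FiniteDimensional ℝ E] [IsManifold I ∞ M]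
  [IsContMDiffRiemannianBundle I ∞ E (fun x : M => TangentSpace I x)]

theorem mdifferentiableAt_inner {X Z : Π x : M, TangentSpace I x} {x : M}
    (hX : MDiffAt (T% X) x) (hZ : MDiffAt (T% Z) x) :
    MDiffAt (fun y => (inner ℝ (X y) (Z y) : ℝ)) x :=
  MDifferentiableAt.inner_bundle (IB := I) (F := E) (E := fun x : M => TangentSpace I x) (b := fun y => y) hX hZ

theorem mvfderiv_inner_smul_left {f : M → ℝ} {X Z : Π x : M, TangentSpace I x} {x : M}
    (hf : MDiffAt f x) (hX : MDiffAt (T% X) x) (hZ : MDiffAt (T% Z) x) (v : TangentSpace I x) :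
    mvfderiv I (fun y => inner ℝ ((f • X) y) (Z y)) x v =
      f x * mvfderiv I (fun y => inner ℝ (X y) (Z y)) x v + mvfderiv I f x v * inner ℝ (X x) (Z x) := by
  have h : (fun y => inner ℝ ((f • X) y) (Z y)) = fun y => f y * inner ℝ (X y) (Z y) := by
    funext y; simp [inner_smul_left]
  rw [h]
  have := mvfderiv_fun_mul hf (mdifferentiableAt_inner hX hZ)
  rw [this]
  simp; ring

theorem mvfderiv_inner_add_left {X X' Z : Π x : M, TangentSpace I x} {x : M}
    (hX : MDiffAt (T% X) x) (hX' : MDiffAt (T% X') x) (hZ : MDiffAt (T% Z) x) (v : TangentSpace I x) :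
    mvfderiv I (fun y => inner ℝ ((X + X') y) (Z y)) x v =
      mvfderiv I (fun y => inner ℝ (X y) (Z y)) x v + mvfderiv I (fun y => inner ℝ (X' y) (Z y)) x v := by
  have h : (fun y => inner ℝ ((X + X') y) (Z y)) = fun y => inner ℝ (X y) (Z y) + inner ℝ (X' y) (Z y) := by
    funext y; simp [inner_add_left]
  rw [h]
  have := mvfderiv_fun_add (mdifferentiableAt_inner hX hZ) (mdifferentiableAt_inner hX' hZ)
  rw [this]
  simp

theorem mvfderiv_inner_comm (X Z : Π x : M, TangentSpace I x) (x : M) :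
    mvfderiv I (fun y => inner ℝ (X y) (Z y)) x = mvfderiv I (fun y => inner ℝ (Z y) (X y)) x := by
  congr 1; funext y; exact real_inner_comm _ _

theorem koszul_smul₁ {f : M → ℝ} {X Y Z : Π x : M, TangentSpace I x} {x : M}
    (hf : MDiffAt f x) (hX : MDiffAt (T% X) x) (hY : MDiffAt (T% Y) x) (hZ : MDiffAt (T% Z) x) :
    koszul I (f • X) Y Z x = f x * koszul I X Y Z x := by
  simp only [koszul]
  rw [mvfderiv_inner_smul_left hf hX hZ, mvfderiv_inner_smul_left hf hX hY,
    mlieBracket_smul_left hf hX, mlieBracket_smul_left hf hX]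
  simp [inner_add_left, inner_smul_left, inner_smul_right]
  ring

theorem koszul_add₁ {X X' Y Z : Π x : M, TangentSpace I x} {x : M}
    (hX : MDiffAt (T% X) x) (hX' : MDiffAt (T% X') x) (hY : MDiffAt (T% Y) x) (hZ : MDiffAt (T% Z) x) :
    koszul I (X + X') Y Z x = koszul I X Y Z x + koszul I X' Y Z x := by
  simp only [koszul]
  rw [mvfderiv_inner_add_left hX hX' hZ, mvfderiv_inner_add_left hX hX' hY,
    mlieBracket_add_left hX hX', mlieBracket_add_left hX hX']
  simp [inner_add_left, inner_add_right]
  ring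

theorem koszul_swap₂₃ (X Y Z : Π x : M, TangentSpace I x) (x : M) :
    koszul I X Y Z x + koszul I X Z Y x = mvfderiv I (fun y => inner ℝ (Y y) (Z y)) x (X x) := by
  simp only [koszul]
  rw [mvfderiv_inner_comm Z Y, mlieBracket_swap_apply (V := Z) (W := Y), inner_neg_left]
  ring

theorem koszul_swap₁₂ (X Y Z : Π x : M, TangentSpace I x) (x : M) :
    koszul I X Y Z x - koszul I Y X Z x = inner ℝ (mlieBracket I X Y x) (Z x) := by
  simp only [koszul]
  rw [mvfderiv_inner_comm Y X, mlieBracket_swap_apply (V := Y) (W := X), inner_neg_left]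
  ring

theorem koszul_smul₂ {f : M → ℝ} {X Y Z : Π x : M, TangentSpace I x} {x : M}
    (hf : MDiffAt f x) (hX : MDiffAt (T% X) x) (hY : MDiffAt (T% Y) x) (hZ : MDiffAt (T% Z) x) :
    koszul I X (f • Y) Z x = f x * koszul I X Y Z x + mvfderiv I f x (X x) * inner ℝ (Y x) (Z x) := by
  have h₁ := koszul_swap₁₂ X (f • Y) Z x
  have h₂ := koszul_swap₁₂ X Y Z x
  rw [koszul_smul₁ hf hY hX hZ, mlieBracket_smul_right hf hY] at h₁
  simp only [inner_add_left, inner_smul_left] at h₁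
  simp at h₁
  linear_combination h₁ - f x * h₂

theorem koszul_add₂ {X Y Y' Z : Π x : M, TangentSpace I x} {x : M}
    (hX : MDiffAt (T% X) x) (hY : MDiffAt (T% Y) x) (hY' : MDiffAt (T% Y') x) (hZ : MDiffAt (T% Z) x) :
    koszul I X (Y + Y') Z x = koszul I X Y Z x + koszul I X Y' Z x := by
  have h₁ := koszul_swap₁₂ X (Y + Y') Z x
  have h₂ := koszul_swap₁₂ X Y Z x
  have h₃ := koszul_swap₁₂ X Y' Z x
  rw [koszul_add₁ hY hY' hX hZ, mlieBracket_add_right hY hY', inner_add_left] at h₁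
  linear_combination h₁ - h₂ - h₃

theorem koszul_smul₃ {f : M → ℝ} {X Y Z : Π x : M, TangentSpace I x} {x : M}
    (hf : MDiffAt f x) (hX : MDiffAt (T% X) x) (hY : MDiffAt (T% Y) x) (hZ : MDiffAt (T% Z) x) :
    koszul I X Y (f • Z) x = f x * koszul I X Y Z x := by
  have h₁ := koszul_swap₂₃ X Y (f • Z) x
  have h₂ := koszul_swap₂₃ X Y Z x
  rw [koszul_smul₂ hf hX hZ hY, mvfderiv_inner_comm, mvfderiv_inner_smul_left hf hZ hY,
    mvfderiv_inner_comm] at h₁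
  linear_combination h₁ - f x * h₂

theorem koszul_add₃ {X Y Z Z' : Π x : M, TangentSpace I x} {x : M}
    (hX : MDiffAt (T% X) x) (hY : MDiffAt (T% Y) x) (hZ : MDiffAt (T% Z) x) (hZ' : MDiffAt (T% Z') x) :
    koszul I X Y (Z + Z') x = koszul I X Y Z x + koszul I X Y Z' x := by
  have h₁ := koszul_swap₂₃ X Y (Z + Z') x
  have h₂ := koszul_swap₂₃ X Y Z x
  have h₃ := koszul_swap₂₃ X Y Z' x
  rw [koszul_add₂ hX hZ hZ' hY, mvfderiv_inner_comm, mvfderiv_inner_add_left hZ hZ' hY,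
    mvfderiv_inner_comm, mvfderiv_inner_comm Z' ] at h₁
  linear_combination h₁ - h₂ - h₃

theorem koszul_tensorial₁ {Y Z : Π x : M, TangentSpace I x} {x : M}
    (hY : MDiffAt (T% Y) x) (hZ : MDiffAt (T% Z) x) :
    TensorialAt I E (fun X => koszul I X Y Z x) x where
  smul hf hX := koszul_smul₁ hf hX hY hZ
  add hX hX' := koszul_add₁ hX hX' hY hZ

theorem koszul_tensorial₃ {X Y : Π x : M, TangentSpace I x} {x : M}
    (hX : MDiffAt (T% X) x) (hY : MDiffAt (T% Y) x) :
    TensorialAt I E (fun Z => koszul I X Y Z x) x where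
  smul hf hZ := koszul_smul₃ hf hX hY hZ
  add hZ hZ' := koszul_add₃ hX hY hZ hZ'

/-- For `Y` differentiable at `x`, the bilinear form `(v, w) ↦ g(∇_v Y, w)` on the tangent space at `x`
given by the Koszul formula. -/
noncomputable def koszulForm (Y : Π x : M, TangentSpace I x) (x : M) :
    TangentSpace I x →L[ℝ] TangentSpace I x →L[ℝ] ℝ :=
  open scoped Classical in
  if hY : MDiffAt (T% Y) x then
    TensorialAt.mkHom₂ (fun X Z => koszul I X Y Z x) x
      (fun _ hZ => koszul_tensorial₁ hY hZ) (fun _ hX => koszul_tensorial₃ hX hY)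
  else 0

theorem koszulForm_apply {X Y Z : Π x : M, TangentSpace I x} {x : M}
    (hX : MDiffAt (T% X) x) (hY : MDiffAt (T% Y) x) (hZ : MDiffAt (T% Z) x) :
    koszulForm Y x (X x) (Z x) = koszul I X Y Z x := by
  rw [koszulForm, dif_pos hY]
  exact TensorialAt.mkHom₂_apply _ _ hX hZ

instance finiteDimensional_tangentSpace (x : M) : FiniteDimensional ℝ (TangentSpace I x) := inferInstanceAs (FiniteDimensional ℝ E)

/-- The endomorphism `A` with `g(A v, w) = B(v, w)`. -/
noncomputable def raise {x : M} (B : TangentSpace I x →L[ℝ] TangentSpace I x →L[ℝ] ℝ) :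
    TangentSpace I x →L[ℝ] TangentSpace I x :=
  ∑ i, (B.flip (stdOrthonormalBasis ℝ (TangentSpace I x) i)).smulRight
    (stdOrthonormalBasis ℝ (TangentSpace I x) i)

theorem inner_raise {x : M} (B : TangentSpace I x →L[ℝ] TangentSpace I x →L[ℝ] ℝ)
    (v w : TangentSpace I x) : inner ℝ (raise B v) w = B v w := by
  conv_rhs => rw [← (stdOrthonormalBasis ℝ (TangentSpace I x)).sum_repr' w]
  simp [raise, sum_inner, inner_smul_left, map_sum, mul_comm]

/-- The Levi-Civita connection of a Riemannian manifold, built from the Koszul formula;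
`leviCivita I M Y x v` is `∇_v Y` at `x`. -/
noncomputable def leviCivita (I : ModelWithCorners ℝ E H) (M : Type*) [TopologicalSpace M] [ChartedSpace H M]
  [RiemannianBundle (fun x : M => TangentSpace I x)] [IsManifold I ∞ M]
  [IsContMDiffRiemannianBundle I ∞ E (fun x : M => TangentSpace I x)] :
    CovariantDerivative I E (fun x : M => TangentSpace I x) where
  toFun Y x := raise (koszulForm Y x)
  isCovariantDerivativeOnUniv :=
    { add := by
        intro Y Y' x hY hY' _
        ext1 v
        refine ext_inner_right ℝ fun w => ?_
        have hv := mdifferentiableAt_extend I E v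
        have hw := mdifferentiableAt_extend I E w
        rw [_root_.add_apply, inner_add_left]
        simp only [inner_raise]
        rw [← extend_apply_self E v, ← extend_apply_self E w,
          koszulForm_apply hv (mdifferentiableAt_add_section hY hY') hw, koszulForm_apply hv hY hw,
          koszulForm_apply hv hY' hw, koszul_add₂ hv hY hY' hw]
      leibniz := by
        intro Y f x hY hf _
        ext1 v
        refine ext_inner_right ℝ fun w => ?_
        have hv := mdifferentiableAt_extend I E v
        have hw := mdifferentiableAt_extend I E w
        rw [_root_.add_apply, inner_add_left, _root_.smul_apply,
          inner_smul_left, ContinuousLinearMap.smulRight_apply, inner_smul_left]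
        simp only [inner_raise]
        rw [← extend_apply_self E v, ← extend_apply_self E w,
          koszulForm_apply hv (hf.smul_section hY) hw, koszulForm_apply hv hY hw,
          koszul_smul₂ hf hv hY hw]
        simp }

theorem inner_leviCivita {X Y Z : Π x : M, TangentSpace I x} {x : M}
    (hX : MDiffAt (T% X) x) (hY : MDiffAt (T% Y) x) (hZ : MDiffAt (T% Z) x) :
    inner ℝ (leviCivita I M Y x (X x)) (Z x) = koszul I X Y Z x := by
  rw [← koszulForm_apply hX hY hZ]
  exact inner_raise _ _ _

/-- The Levi-Civita connection is torsion-free. -/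
theorem leviCivita_torsion : (leviCivita I M).torsion = 0 := by
  rw [CovariantDerivative.torsion_eq_zero_iff]
  intro X Y x hX hY
  refine ext_inner_right ℝ fun w => ?_
  have hw := mdifferentiableAt_extend I E w
  rw [← extend_apply_self E w, inner_sub_left, inner_leviCivita hX hY hw,
    inner_leviCivita hY hX hw, koszul_swap₁₂]

/-- The Levi-Civita connection is metric: `X g(Y, Z) = g(∇_X Y, Z) + g(Y, ∇_X Z)`. -/
theorem leviCivita_metric {X Y Z : Π x : M, TangentSpace I x} {x : M}
    (hX : MDiffAt (T% X) x) (hY : MDiffAt (T% Y) x) (hZ : MDiffAt (T% Z) x) :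
    mvfderiv I (fun y => (inner ℝ (Y y) (Z y) : ℝ)) x (X x) =
      inner ℝ (leviCivita I M Y x (X x)) (Z x) + inner ℝ (Y x) (leviCivita I M Z x (X x)) := by
  rw [real_inner_comm _ (Y x), inner_leviCivita hX hY hZ, inner_leviCivita hX hZ hY, koszul_swap₂₃]

/-- The curvature tensor `R(u, v) w = ∇_U ∇_V W - ∇_V ∇_U W - ∇_[U,V] W` at `x`, where `U`, `V`, `W` are
local vector fields extending the tangent vectors `u`, `v`, `w` at `x`. -/
noncomputable def curvature (x : M) (u v w : TangentSpace I x) : TangentSpace I x :=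
  let U : Π y : M, TangentSpace I y := extend E u
  let V : Π y : M, TangentSpace I y := extend E v
  let W : Π y : M, TangentSpace I y := extend E w
  leviCivita I M (fun y => leviCivita I M W y (V y)) x u
    - leviCivita I M (fun y => leviCivita I M W y (U y)) x v
    - leviCivita I M W x (mlieBracket I U V x)

/-- The scalar curvature `s = ∑_{i,j} g(R(e_i, e_j) e_j, e_i)`, for an orthonormal basis `e`. -/
noncomputable def scalarCurvature (I : ModelWithCorners ℝ E H) {M : Type*} [TopologicalSpace M]
    [ChartedSpace H M] [RiemannianBundle (fun x : M => TangentSpace I x)] [IsManifold I ∞ M]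
    [IsContMDiffRiemannianBundle I ∞ E (fun x : M => TangentSpace I x)] (x : M) : ℝ :=
  let e := stdOrthonormalBasis ℝ (TangentSpace I x)
  ∑ i, ∑ j, inner ℝ (curvature x (e i) (e j) (e j)) (e i)

end LeviCivita

section Model

/-- The Kronecker delta. -/
def delta (a b : Fin 7) : ℤ := if a = b then 1 else 0

/-- The value of the 3-form `e^a ∧ e^b ∧ e^c` on the standard basis vectors `e_i, e_j, e_k`. -/
def wedge3 (a b c i j k : Fin 7) : ℤ :=
  delta a i * (delta b j * delta c k - delta b k * delta c j)
    - delta a j * (delta b i * delta c k - delta b k * delta c i)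
    + delta a k * (delta b i * delta c j - delta b j * delta c i)

/-- The components of the standard 3-form
`φ = e^123 + e^145 + e^167 + e^246 - e^257 - e^347 - e^356` on `ℝ^7`; the indices `1, ..., 7` are
written `0, ..., 6`. -/
def eps (i j k : Fin 7) : ℤ :=
  wedge3 0 1 2 i j k + wedge3 0 3 4 i j k + wedge3 0 5 6 i j k + wedge3 1 3 5 i j k
    - wedge3 1 4 6 i j k - wedge3 2 3 6 i j k - wedge3 2 4 5 i j k

theorem eps_cyclic (i j k : Fin 7) : eps i j k = eps j k i := by
  simp only [eps, wedge3]; ring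

/-- Real `7 × 7` matrices, with the inner product `⟨a, b⟩ = ∑ a_ij b_ij`. -/
abbrev MatSpace := EuclideanSpace ℝ (Fin 7 × Fin 7)

/-- The Lie algebra of `SO(7)`: skew-symmetric matrices. -/
def so7 : Submodule ℝ MatSpace where
  carrier := {a | ∀ i j, a (j, i) = -a (i, j)}
  zero_mem' := by simp
  add_mem' := by
    intro a b ha hb i j
    simp only [PiLp.add_apply, ha i j, hb i j]; ring
  smul_mem' := by
    intro c a ha i j
    simp only [PiLp.smul_apply, ha i j, smul_eq_mul]; ring

/-- The Lie algebra of `G_2`, the stabilizer of the standard 3-form in `SO(7)`: skew-symmetric `a`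
with `φ(a e_i, e_j, e_k) + φ(e_i, a e_j, e_k) + φ(e_i, e_j, a e_k) = 0`. -/
def g2 : Submodule ℝ MatSpace where
  carrier := {a | a ∈ so7 ∧ ∀ i j k,
    ∑ l, (a (l, i) * eps l j k + a (l, j) * eps i l k + a (l, k) * eps i j l) = 0}
  zero_mem' := by simp [so7.zero_mem]
  add_mem' := by
    rintro a b ⟨ha, ha'⟩ ⟨hb, hb'⟩
    refine ⟨so7.add_mem ha hb, fun i j k => ?_⟩
    rw [← add_zero (0 : ℝ)]
    nth_rw 1 [← ha' i j k]
    rw [← hb' i j k, ← Finset.sum_add_distrib]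
    refine Finset.sum_congr rfl fun l _ => ?_
    simp only [PiLp.add_apply]; ring
  smul_mem' := by
    rintro c a ⟨ha, ha'⟩
    refine ⟨so7.smul_mem c ha, fun i j k => ?_⟩
    rw [← mul_zero c, ← ha' i j k, Finset.mul_sum]
    refine Finset.sum_congr rfl fun l _ => ?_
    simp only [PiLp.smul_apply, smul_eq_mul]; ring

/-- The orthogonal complement of the Lie algebra of `G_2` in the Lie algebra of `SO(7)`. -/
noncomputable def g2Perp : Submodule ℝ MatSpace := so7 ⊓ g2ᗮ

def lineFst : Fin 7 → Fin 3 → Fin 7 :=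
  ![![1, 3, 5], ![2, 3, 6], ![0, 6, 5], ![4, 5, 2], ![0, 1, 2], ![6, 1, 4], ![0, 4, 3]]
def lineSnd : Fin 7 → Fin 3 → Fin 7 :=
  ![![2, 4, 6], ![0, 5, 4], ![1, 3, 4], ![0, 1, 6], ![3, 6, 5], ![0, 3, 2], ![5, 1, 2]]

def unitSkew (a b i j : Fin 7) : ℤ := delta i a * delta j b - delta i b * delta j a

def testMat (m : Fin 7) (s : Fin 3) (i j : Fin 7) : ℤ :=
  unitSkew (lineFst m s) (lineSnd m s) i j - unitSkew (lineFst m 0) (lineSnd m 0) i j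

theorem testMat_skew : ∀ m s i j, testMat m s j i = - testMat m s i j := by decide +kernel

def stabTerm (a b i j k : Fin 7) : ℤ :=
  (if i = b then eps a j k else 0) - (if i = a then eps b j k else 0)
    + ((if j = b then eps i a k else 0) - (if j = a then eps i b k else 0))
    + ((if k = b then eps i j a else 0) - (if k = a then eps i j b else 0))

def crossSign : Fin 7 → Fin 7 → ℤ :=
  ![![0, 1, -1, 1, -1, 1, -1], ![-1, 0, 1, 1, -1, -1, 1], ![1, -1, 0, -1, -1, 1, 1], ![-1, -1, 1, 0, 1, 1, -1], ![1, 1, 1, -1, 0, -1, -1], ![-1, 1, -1, -1, 1, 0, 1], ![1, -1, -1, 1, 1, -1, 0]]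
def crossIndex : Fin 7 → Fin 7 → Fin 7 :=
  ![![0, 2, 1, 4, 3, 6, 5], ![2, 0, 0, 5, 6, 3, 4], ![1, 0, 0, 6, 5, 4, 3], ![4, 5, 6, 0, 0, 1, 2], ![3, 6, 5, 0, 0, 2, 1], ![6, 3, 4, 1, 2, 0, 0], ![5, 4, 3, 2, 1, 0, 0]]

theorem eps_eq_ite : ∀ i j k, eps i j k = if k = crossIndex i j then crossSign i j else 0 := by
  decide +kernel

theorem stabTerm_line : ∀ m s i j k,
    stabTerm (lineFst m s) (lineSnd m s) i j k = stabTerm (lineFst m 0) (lineSnd m 0) i j k := by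
  simp only [stabTerm, eps_eq_ite]
  decide +kernel

theorem sum_unitSkew (a b i j k : Fin 7) :
    ∑ l, (unitSkew a b l i * eps l j k + unitSkew a b l j * eps i l k
      + unitSkew a b l k * eps i j l) = stabTerm a b i j k := by
  simp [unitSkew, stabTerm, delta, Finset.sum_add_distrib, sub_mul, Finset.sum_sub_distrib]

theorem testMat_stab (m : Fin 7) (s : Fin 3) (i j k : Fin 7) :
    ∑ l, (testMat m s l i * eps l j k + testMat m s l j * eps i l k
      + testMat m s l k * eps i j l) = 0 := by
  have h := stabTerm_line m s i j k
  rw [← sum_unitSkew, ← sum_unitSkew, ← sub_eq_zero, ← Finset.sum_sub_distrib] at h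
  rw [← h]
  refine Finset.sum_congr rfl fun l _ => ?_
  simp only [testMat]; ring

theorem eps_swap (i j k : Fin 7) : eps i j k = -eps j i k := by
  simp only [eps, wedge3]; ring

theorem eps_line : ∀ m s k, eps (lineFst m s) (lineSnd m s) k = delta k m := by decide +kernel

theorem exists_line : ∀ i j : Fin 7, i = j ∨ ∃ m s, (i = lineFst m s ∧ j = lineSnd m s) ∨
    (i = lineSnd m s ∧ j = lineFst m s) := by decide +kernel

theorem sum_delta (f : Fin 7 → ℝ) (a : Fin 7) : ∑ i, (delta i a : ℝ) * f i = f a := by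
  simp [delta]

/-- Every element of the orthogonal complement of the Lie algebra of `G_2` has the form `∑_k ε_ijk v_k`. -/
theorem apply_of_mem_g2Perp {z : MatSpace} (hz : z ∈ g2Perp) :
    ∀ i j, z (i, j) = ∑ k, (eps i j k : ℝ) * z (lineFst k 0, lineSnd k 0) := by
  obtain ⟨hs, ho⟩ := hz
  have hs : ∀ i j, z (j, i) = -z (i, j) := hs
  have key : ∀ m s, z (lineFst m s, lineSnd m s) = z (lineFst m 0, lineSnd m 0) := by
    intro m s
    have hmem : (WithLp.toLp 2 (fun p : Fin 7 × Fin 7 => (testMat m s p.1 p.2 : ℝ)) : MatSpace) ∈ g2 := by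
      refine ⟨fun i j => ?_, fun i j k => ?_⟩
      · simp [testMat_skew m s i j]
      · have := congrArg (Int.cast : ℤ → ℝ) (testMat_stab m s i j k)
        push_cast at this
        simpa using this
    have h := ho _ hmem
    have hu : ∀ a b : Fin 7, ∑ i, ∑ j, (unitSkew a b i j : ℝ) * z (i, j) = 2 * z (a, b) := by
      intro a b
      simp only [unitSkew, Int.cast_sub, Int.cast_mul, sub_mul, mul_assoc, Finset.sum_sub_distrib,
        ← Finset.mul_sum, sum_delta]
      linarith [hs a b]
    simp only [PiLp.inner_apply, Fintype.sum_prod_type, testMat, Int.cast_sub] at h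
    simp [mul_comm] at h
    simp only [sub_mul, Finset.sum_sub_distrib, hu] at h
    linarith
  intro i j
  have hline : ∀ m s, z (lineFst m s, lineSnd m s) =
      ∑ k, (eps (lineFst m s) (lineSnd m s) k : ℝ) * z (lineFst k 0, lineSnd k 0) := by
    intro m s
    simp only [eps_line, sum_delta (fun k => z (lineFst k 0, lineSnd k 0))]
    exact key m s
  rcases exists_line i j with rfl | ⟨m, s, ⟨rfl, rfl⟩ | ⟨rfl, rfl⟩⟩
  · have h0 : ∀ k, eps i i k = 0 := fun k => by have := eps_swap i i k; omega
    simp only [h0]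
    simp; linarith [hs i i]
  · exact hline m s
  · rw [hs (lineFst m s) (lineSnd m s), hline m s, ← Finset.sum_neg_distrib]
    refine Finset.sum_congr rfl fun k _ => ?_
    rw [eps_swap (lineSnd m s)]; push_cast; ring

end Model

section G2Structure

/-- Local notation for the Euclidean model space of dimension 7. -/
local notation "E7" => EuclideanSpace ℝ (Fin 7)

variable {M : Type*} [TopologicalSpace M] [ChartedSpace E7 M] [IsManifold (𝓡 7) ∞ M]
  [RiemannianBundle (fun x : M => TangentSpace (𝓡 7) x)]

/-- A field of trilinear forms on the tangent spaces. -/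
abbrev TrilinearField (M : Type*) [TopologicalSpace M] [ChartedSpace E7 M] :=
  Π x : M, TangentSpace (𝓡 7) x →ₗ[ℝ] TangentSpace (𝓡 7) x →ₗ[ℝ] TangentSpace (𝓡 7) x →ₗ[ℝ] ℝ

/-- A smooth orthonormal frame on `U` in which the form `φ` has the standard components, i.e. a local
section over `U` of the reduction of the orthonormal frame bundle to `G_2`. -/
structure IsAdaptedFrameOn (φ : TrilinearField M) (e : Fin 7 → Π x : M, TangentSpace (𝓡 7) x)
    (U : Set M) : Prop where
  smooth : ∀ i, ContMDiffOn (𝓡 7) ((𝓡 7).prod 𝓘(ℝ, E7)) ∞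
    (fun y => TotalSpace.mk' E7 (E := fun x : M => TangentSpace (𝓡 7) x) y (e i y)) U
  orthonormal : ∀ x ∈ U, Orthonormal ℝ (fun i => e i x)
  form_eq : ∀ x ∈ U, ∀ i j k, φ x (e i x) (e j x) (e k x) = eps i j k

/-- A `G_2`-structure on the Riemannian manifold `M`: a global 3-form which near each point is the
standard 3-form in a smooth local orthonormal frame. These frames also define the orientation. -/
structure G2Structure (M : Type*) [TopologicalSpace M] [ChartedSpace E7 M]
    [IsManifold (𝓡 7) ∞ M] [RiemannianBundle (fun x : M => TangentSpace (𝓡 7) x)] where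
  form : TrilinearField M
  exists_frame : ∀ x : M, ∃ U : Set M, IsOpen U ∧ x ∈ U ∧ ∃ e, IsAdaptedFrameOn form e U

namespace G2Structure

variable (G : G2Structure M)

/-- The cross product, `g(u × v, w) = φ(u, v, w)`. -/
noncomputable def cross (x : M) :
    TangentSpace (𝓡 7) x →ₗ[ℝ] TangentSpace (𝓡 7) x →ₗ[ℝ] TangentSpace (𝓡 7) x :=
  LinearMap.mk₂ ℝ
    (fun u v => ∑ i, G.form x u v (stdOrthonormalBasis ℝ (TangentSpace (𝓡 7) x) i) •
      stdOrthonormalBasis ℝ (TangentSpace (𝓡 7) x) i)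
    (fun u u' v => by simp [add_smul, Finset.sum_add_distrib])
    (fun c u v => by simp [mul_smul, Finset.smul_sum])
    (fun u v v' => by simp [add_smul, Finset.sum_add_distrib])
    (fun c u v => by simp [mul_smul, Finset.smul_sum])

theorem inner_cross (x : M) (u v w : TangentSpace (𝓡 7) x) :
    inner ℝ (G.cross x u v) w = G.form x u v w := by
  conv_rhs => rw [← (stdOrthonormalBasis ℝ (TangentSpace (𝓡 7) x)).sum_repr' w]
  simp [cross, sum_inner, inner_smul_left, map_sum, mul_comm]

/-- An adapted local frame around `x`. -/
noncomputable def frame (x : M) : Fin 7 → Π y : M, TangentSpace (𝓡 7) y :=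
  (G.exists_frame x).choose_spec.2.2.choose

theorem frame_spec (x : M) : ∃ U : Set M, IsOpen U ∧ x ∈ U ∧ IsAdaptedFrameOn G.form (G.frame x) U :=
  ⟨_, (G.exists_frame x).choose_spec.1, (G.exists_frame x).choose_spec.2.1,
    (G.exists_frame x).choose_spec.2.2.choose_spec⟩

theorem frame_orthonormal (x : M) : Orthonormal ℝ (fun i => G.frame x i x) := by
  obtain ⟨U, -, hx, h⟩ := G.frame_spec x
  exact h.orthonormal x hx

theorem frame_form (x : M) (i j k : Fin 7) :
    G.form x (G.frame x i x) (G.frame x j x) (G.frame x k x) = eps i j k := by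
  obtain ⟨U, -, hx, h⟩ := G.frame_spec x
  exact h.form_eq x hx i j k

/-- The values at `x` of an adapted frame around `x`, as an orthonormal basis. -/
noncomputable def frameBasis (x : M) : OrthonormalBasis (Fin 7) ℝ (TangentSpace (𝓡 7) x) :=
  OrthonormalBasis.mk (G.frame_orthonormal x) (by
    have h : Module.finrank ℝ (TangentSpace (𝓡 7) x) = 7 := finrank_euclideanSpace_fin (𝕜 := ℝ) (n := 7)
    rw [(G.frame_orthonormal x).linearIndependent.span_eq_top_of_card_eq_finrank' (by simp [h])])

theorem frameBasis_apply (x : M) (i : Fin 7) : G.frameBasis x i = G.frame x i x := by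
  simp [frameBasis]

theorem cross_frameBasis (x : M) (j k : Fin 7) :
    G.cross x (G.frameBasis x j) (G.frameBasis x k) = ∑ i, (eps i j k : ℝ) • G.frameBasis x i := by
  refine (G.frameBasis x).repr.injective ?_
  ext l
  rw [OrthonormalBasis.repr_apply_apply, OrthonormalBasis.repr_apply_apply, real_inner_comm,
    inner_cross, real_inner_comm]
  simp only [frameBasis_apply, frame_form, sum_inner, inner_smul_left,
    orthonormal_iff_ite.mp (G.frame_orthonormal x)]
  simp [eps_cyclic l j k]

variable [IsContMDiffRiemannianBundle (𝓡 7) ∞ E7 (fun x : M => TangentSpace (𝓡 7) x)]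

/-- The connection form of the Levi-Civita connection in an adapted frame `e` around `x`: the matrix
`ω(v)_ij = g(∇_v e_j, e_i)`, so that `∇_v e_j = ∑_i ω(v)_ij e_i`. -/
noncomputable def connectionForm (x : M) : TangentSpace (𝓡 7) x →ₗ[ℝ] MatSpace where
  toFun v := WithLp.toLp 2 fun p =>
    inner ℝ (leviCivita (𝓡 7) M (G.frame x p.2) x v) (G.frame x p.1 x)
  map_add' u v := by ext p; simp [inner_add_left]
  map_smul' c v := by ext p; simp [inner_smul_left]

/-- The endomorphism of the tangent space at `x` with a given matrix in the adapted frame. -/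
noncomputable def endOfMatrix (x : M) (a : MatSpace) :
    TangentSpace (𝓡 7) x →ₗ[ℝ] TangentSpace (𝓡 7) x :=
  ∑ i, ∑ j, (a (i, j)) • ((innerSL ℝ (G.frame x j x)).toLinearMap.smulRight (G.frame x i x))

/-- The intrinsic torsion `ξ`: `-ξ_v` is given in the adapted frame by the component of the
Levi-Civita connection form `ω(v)` in the orthogonal complement of the Lie algebra of `G_2`. -/
noncomputable def intrinsicTorsion (x : M) (v : TangentSpace (𝓡 7) x) :
    TangentSpace (𝓡 7) x →ₗ[ℝ] TangentSpace (𝓡 7) x :=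
  -G.endOfMatrix x (g2Perp.starProjection (G.connectionForm x v))

theorem exists_torsionEndomorphism (x : M) :
    ∃ T : Module.End ℝ (TangentSpace (𝓡 7) x),
      ∀ v w, G.intrinsicTorsion x v w = G.cross x w (T v) := by
  let z : TangentSpace (𝓡 7) x → MatSpace := fun v => g2Perp.starProjection (G.connectionForm x v)
  have hz : ∀ v, z v ∈ g2Perp := fun v => g2Perp.starProjection_apply_mem _
  refine ⟨{
    toFun := fun v => -∑ k, z v (lineFst k 0, lineSnd k 0) • G.frameBasis x k
    map_add' := fun u v => by
      simp only [z, map_add, PiLp.add_apply, add_smul, Finset.sum_add_distrib, neg_add]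
    map_smul' := fun c v => by
      simp only [z, map_smul, PiLp.smul_apply, smul_eq_mul, mul_smul, ← Finset.smul_sum,
        RingHom.id_apply, smul_neg] }, fun v w => ?_⟩
  have hw : w = ∑ j, inner ℝ (G.frameBasis x j) w • G.frameBasis x j :=
    ((G.frameBasis x).sum_repr' w).symm
  have h1 : G.intrinsicTorsion x v w =
      -∑ i, ∑ j, (z v (i, j) * inner ℝ (G.frameBasis x j) w) • G.frameBasis x i := by
    simp [intrinsicTorsion, endOfMatrix, LinearMap.sum_apply, frameBasis_apply, mul_smul, z]
  rw [h1]
  conv_rhs => rw [hw]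
  simp only [LinearMap.coe_mk, AddHom.coe_mk, map_neg, map_sum, map_smul, LinearMap.sum_apply,
    LinearMap.smul_apply, cross_frameBasis, Finset.smul_sum, smul_smul]
  congr 1
  have h2 : ∀ i j, (z v (i, j) * inner ℝ (G.frameBasis x j) w) • G.frameBasis x i =
      ∑ k, (z v (lineFst k 0, lineSnd k 0) * (inner ℝ (G.frameBasis x j) w * (eps i j k : ℝ))) •
        G.frameBasis x i := by
    intro i j
    rw [apply_of_mem_g2Perp (hz v) i j, Finset.sum_mul, Finset.sum_smul]
    refine Finset.sum_congr rfl fun k _ => ?_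
    congr 1; ring
  simp_rw [h2]
  rw [Finset.sum_congr rfl fun i _ => Finset.sum_comm, Finset.sum_comm]
  exact Finset.sum_congr rfl fun k _ => Finset.sum_comm

/-- The endomorphism `T` of the tangent space with `ξ_v w = w × T(v)`. -/
noncomputable def torsionEndomorphism (x : M) : Module.End ℝ (TangentSpace (𝓡 7) x) :=
  (G.exists_torsionEndomorphism x).choose

theorem intrinsicTorsion_eq (x : M) (v w : TangentSpace (𝓡 7) x) :
    G.intrinsicTorsion x v w = G.cross x w (G.torsionEndomorphism x v) :=
  (G.exists_torsionEndomorphism x).choose_spec v w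

/-- The tensor `ξ_v w = w × t(v)` induced by an endomorphism `t`. -/
noncomputable def inducedTensor (x : M) (t : Module.End ℝ (TangentSpace (𝓡 7) x))
    (v : TangentSpace (𝓡 7) x) : TangentSpace (𝓡 7) x →ₗ[ℝ] TangentSpace (𝓡 7) x :=
  (G.cross x).flip (t v)

/-- The characteristic vector field `χ = tr ξ = ∑_i ξ_{e_i} e_i` of the intrinsic torsion. -/
noncomputable def characteristicVector (x : M) : TangentSpace (𝓡 7) x :=
  let e := stdOrthonormalBasis ℝ (TangentSpace (𝓡 7) x)
  ∑ i, G.intrinsicTorsion x (e i) (e i)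

/-- The trace of the tensor induced by an endomorphism `t`; for a component `t` of the endomorphism
`T` of the structure, this is the corresponding component of the characteristic vector field. -/
noncomputable def characteristicVectorOf (x : M) (t : Module.End ℝ (TangentSpace (𝓡 7) x)) :
    TangentSpace (𝓡 7) x :=
  let e := stdOrthonormalBasis ℝ (TangentSpace (𝓡 7) x)
  ∑ i, G.inducedTensor x t (e i) (e i)

/-- The fibre at `x` of the class `X_1`: multiples of the identity. -/
noncomputable def classOne (x : M) : Submodule ℝ (Module.End ℝ (TangentSpace (𝓡 7) x)) :=
  Submodule.span ℝ {1}

/-- The fibre at `x` of the class `X_2`: the Lie algebra of the stabilizer of `φ_x` in the special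
orthogonal group of the tangent space. -/
noncomputable def classTwo (x : M) : Submodule ℝ (Module.End ℝ (TangentSpace (𝓡 7) x)) where
  carrier := {a | (∀ u v, inner ℝ (a u) v = -(inner ℝ u (a v) : ℝ)) ∧
    ∀ u v w, G.form x (a u) v w + G.form x u (a v) w + G.form x u v (a w) = 0}
  zero_mem' := by simp
  add_mem' := by
    rintro a b ⟨ha, ha'⟩ ⟨hb, hb'⟩
    refine ⟨fun u v => ?_, fun u v w => ?_⟩
    · simp only [LinearMap.add_apply, inner_add_left, inner_add_right, ha, hb]; ring
    · simp only [LinearMap.add_apply, map_add]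
      linear_combination ha' u v w + hb' u v w
  smul_mem' := by
    rintro c a ⟨ha, ha'⟩
    refine ⟨fun u v => ?_, fun u v w => ?_⟩
    · simp only [LinearMap.smul_apply, inner_smul_left, inner_smul_right, ha]; simp
    · simp only [LinearMap.smul_apply, map_smul, smul_eq_mul]
      linear_combination c * ha' u v w

/-- The fibre at `x` of the class `X_3`: symmetric trace-free endomorphisms. -/
noncomputable def classThree (x : M) : Submodule ℝ (Module.End ℝ (TangentSpace (𝓡 7) x)) where
  carrier := {a | (∀ u v, inner ℝ (a u) v = (inner ℝ u (a v) : ℝ)) ∧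
    LinearMap.trace ℝ (TangentSpace (𝓡 7) x) a = 0}
  zero_mem' := by simp
  add_mem' := by
    rintro a b ⟨ha, ha'⟩ ⟨hb, hb'⟩
    refine ⟨fun u v => ?_, by rw [map_add, ha', hb', add_zero]⟩
    simp only [LinearMap.add_apply, inner_add_left, inner_add_right, ha, hb]
  smul_mem' := by
    rintro c a ⟨ha, ha'⟩
    refine ⟨fun u v => ?_, by rw [map_smul, ha', smul_zero]⟩
    simp only [LinearMap.smul_apply, inner_smul_left, inner_smul_right, ha]; simp

/-- The fibre at `x` of the class `X_4`: endomorphisms `u ↦ u × Z` induced by a tangent vector `Z`. -/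
noncomputable def classFour (x : M) : Submodule ℝ (Module.End ℝ (TangentSpace (𝓡 7) x)) :=
  LinearMap.range (G.cross x).flip

/-- The structure is of type `X_1 ⊕ X_2 ⊕ X_3`. -/
def IsOfTypeOneTwoThree : Prop :=
  ∀ x : M, G.torsionEndomorphism x ∈ classOne x ⊔ G.classTwo x ⊔ classThree x

/-- `T = t_1 + t_2 + t_3 + t_4` at `x`, where `t_i` lies in the class `X_i` and `t_4` is induced by the
tangent vector `Z`. The indices of `t` are written `0, ..., 3`. -/
structure IsDecompositionAt (x : M) (t : Fin 4 → Module.End ℝ (TangentSpace (𝓡 7) x))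
    (Z : TangentSpace (𝓡 7) x) : Prop where
  one : t 0 ∈ classOne x
  two : t 1 ∈ G.classTwo x
  three : t 2 ∈ classThree x
  four : t 3 ∈ G.classFour x
  sum_eq : G.torsionEndomorphism x = t 0 + t 1 + t 2 + t 3
  induced : ∀ u, t 3 u = G.cross x u Z

/-- The quadratic invariant `i_0(α) = ∑_{i,j} g(α(e_i) × α(e_j), e_i × e_j)`. -/
noncomputable def iZero (x : M) (α : Module.End ℝ (TangentSpace (𝓡 7) x)) : ℝ :=
  let e := stdOrthonormalBasis ℝ (TangentSpace (𝓡 7) x)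
  ∑ i, ∑ j, inner ℝ (G.cross x (α (e i)) (α (e j))) (G.cross x (e i) (e j))

end G2Structure

/-- The second elementary symmetric function of an endomorphism `α` of a real vector space of
dimension 7. In `det(λ I - α) = -det(α - λ I) = ∑_i (-1)^(7-i) σ_(7-i)(α) λ^i` it is the coefficient
of `λ^5`. -/
noncomputable def sigmaTwo {V : Type*} [AddCommGroup V] [Module ℝ V] [FiniteDimensional ℝ V]
    (α : Module.End ℝ V) : ℝ :=
  (LinearMap.charpoly α).coeff 5

end G2Structure

end G2Geometry

/-!
In an adapted frame `e_a` write `ω_a` for the matrix of `∇_{e_a}`, and `E_m` for the matrix with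
entries `ε_mij`, which up to sign is the cross product with `e_m`.

The complement of `𝔤₂` in `𝔰𝔬(7)` is spanned by the `E_m`, and the projection onto it is
contraction with `ε` (`starProjection_g2Perp`). Hence the definition of the torsion endomorphism
reads `tr(E_m ω_a) = 6 T_ma`, and `A_a = ω_a + ∑ T_na E_n` lies in `𝔤₂`. The intrinsic torsion at
each point refers to a frame chosen for that point; differentiating along one frame therefore needs
that `∑_l e_l × ∇_v e_l = 6 T(v)` in every adapted frame, which holds because the logarithmic
derivative of a change of adapted frame is in `𝔤₂` (`G2Structure.sum_cross_frame_eq`,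
`G2Structure.trace_crossMatrix_mul_connectionMatrix`).

Now contract the curvature matrices `K_ab` with `ε_abm E_m`. Since `∑_m ε_abm ε_lkm` is
`δ_al δ_bk - δ_ak δ_bl` plus a totally skew term `ψ_ablk`, the first Bianchi identity makes this
contraction equal to `-2 s` (`sum_eps_mul_trace`). Computed from the structure equation
`K = dω + ω ∧ ω`, it has terms with derivatives of `ω`, which form the divergence of the
characteristic vector field and vanish with it, and quadratic terms. Every `A ∈ 𝔤₂` acts as a
derivation of the cross product, `[A, E_m] = ∑ A_lm E_l` (`commutator_crossMatrix`), so the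
components `A_a` drop out of the quadratic terms (`quadratic_contraction`). What remains is
`s = -9 i_0(T) + 18 ((tr T)² - tr T²)`, and `(tr T)² - tr T² = 2 σ_2(T)`.

The characteristic vector of an endomorphism is its contraction with `ε`. It vanishes on symmetric
endomorphisms by skew-symmetry and on `𝔤₂` by orthogonality, and equals `-6 Z` on `u ↦ u × Z`.
Conversely a skew-symmetric endomorphism without characteristic vector lies in `𝔤₂`. This gives the
decomposition: `Z` is read off from the characteristic vector, and the rest is split into its
skew-symmetric, trace and symmetric trace-free parts.
-/

/-! ### The second coefficient of the characteristic polynomial -/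

open Finset in
/-- Twice the sum of the principal `2 × 2` minors, expressed through traces. -/
theorem Matrix.two_mul_charpoly_coeff_card_sub_two {n R : Type*} [Fintype n] [DecidableEq n]
    [CommRing R] (M : Matrix n n R) (h : 2 ≤ Fintype.card n) :
    2 * M.charpoly.coeff (Fintype.card n - 2) = M.trace ^ 2 - (M * M).trace := by
  have hminor : ∀ i j : n, i ≠ j →
      (M.submatrix (Subtype.val : ({i, j} : Finset n) → n) Subtype.val).det =
        M i i * M j j - M i j * M j i := by
    intro i j hij
    let f : Fin 2 → ({i, j} : Finset n) := ![⟨i, by simp⟩, ⟨j, by simp⟩]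
    have hf : Function.Bijective f := by
      constructor
      · intro a b hab
        fin_cases a <;> fin_cases b <;> simp_all [f]
      · rintro ⟨a, ha⟩
        rcases Finset.mem_insert.1 ha with rfl | ha
        · exact ⟨0, rfl⟩
        · rw [Finset.mem_singleton] at ha
          subst ha
          exact ⟨1, rfl⟩
    rw [← Matrix.det_submatrix_equiv_self (Equiv.ofBijective f hf), Matrix.det_fin_two]
    simp [f]
  rw [Matrix.charpoly_coeff_eq_sum_minors M 2 h]
  have hoff : ∑ p ∈ (univ : Finset n).offDiag, (M p.1 p.1 * M p.2 p.2 - M p.1 p.2 * M p.2 p.1) =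
      ∑ s ∈ univ.powersetCard 2, 2 * (M.submatrix (Subtype.val : s → n) Subtype.val).det := by
    rw [← Finset.sum_fiberwise_of_maps_to (t := univ.powersetCard 2)
      (g := fun p : n × n => ({p.1, p.2} : Finset n))]
    · refine Finset.sum_congr rfl fun s hs => ?_
      obtain ⟨i, j, hij, rfl⟩ := Finset.card_eq_two.1 (Finset.mem_powersetCard.1 hs).2
      have : (univ : Finset n).offDiag.filter (fun p => ({p.1, p.2} : Finset n) = {i, j}) =
          {(i, j), (j, i)} := by
        ext ⟨a, b⟩
        simp only [Finset.mem_filter, Finset.mem_offDiag, Finset.mem_univ, true_and,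
          Finset.mem_insert, Finset.mem_singleton, Prod.mk.injEq]
        constructor
        · rintro ⟨hab, h⟩
          have ha : a = i ∨ a = j := by
            have : a ∈ ({i, j} : Finset n) := h ▸ by simp
            simpa using this
          have hb : b = i ∨ b = j := by
            have : b ∈ ({i, j} : Finset n) := h ▸ by simp
            simpa using this
          rcases ha with rfl | rfl <;> rcases hb with rfl | rfl <;> simp_all
        · rintro (⟨rfl, rfl⟩ | ⟨rfl, rfl⟩)
          · exact ⟨hij, rfl⟩
          · exact ⟨hij.symm, Finset.pair_comm _ _⟩
      rw [this, Finset.sum_pair (by simp [hij]), hminor i j hij]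
      ring
    · intro p hp
      rw [Finset.mem_powersetCard]
      exact ⟨Finset.subset_univ _, Finset.card_pair (Finset.mem_offDiag.1 hp).2.2⟩
  have hall : ∑ p : n × n, (M p.1 p.1 * M p.2 p.2 - M p.1 p.2 * M p.2 p.1) =
      ∑ p ∈ (univ : Finset n).offDiag, (M p.1 p.1 * M p.2 p.2 - M p.1 p.2 * M p.2 p.1) := by
    refine (Finset.sum_subset (Finset.subset_univ _) ?_).symm
    rintro ⟨a, b⟩ - hab
    have : a = b := by simpa using hab
    subst this
    ring
  rw [neg_one_sq, one_mul, Finset.mul_sum, ← hoff, ← hall, Fintype.sum_prod_type]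
  simp only [Finset.sum_sub_distrib, ← Finset.mul_sum, ← Finset.sum_mul, Matrix.trace, sq,
    Matrix.diag_apply, Matrix.mul_apply]

namespace G2Geometry

open scoped Matrix

/-! ### Identities for the standard 3-form -/

theorem eps_swap_right (i j k : Fin 7) : eps i j k = -eps i k j := by
  simp only [eps, wedge3]; ring

/-- The 4-form dual to the standard 3-form, as the trace-free part of the contraction of the 3-form
with itself in one index. -/
def psi (i j k l : Fin 7) : ℤ :=
  ∑ m, eps i j m * eps k l m - delta i k * delta j l + delta i l * delta j k

theorem sum_eps_mul_eps (i j k l : Fin 7) :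
    ∑ m, eps i j m * eps k l m = delta i k * delta j l - delta i l * delta j k + psi i j k l := by
  simp only [psi]; ring

/-- Contraction with `ε_ij·` has at most one nonzero term. -/
theorem sum_eps_mul (i j : Fin 7) (f : Fin 7 → ℤ) :
    ∑ k, eps i j k * f k = crossSign i j * f (crossIndex i j) := by
  simp [eps_eq_ite]

theorem psi_cyclic (i j k l : Fin 7) : psi i j l k = psi j k l i := by
  revert i j k l
  simp only [psi, eps_eq_ite, delta]
  decide +kernel

theorem psi_cyclic_first (i j k l : Fin 7) : psi i j k l = psi k i j l := by
  revert i j k l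
  simp only [psi, eps_eq_ite, delta]
  decide +kernel

theorem psi_swap_left (i j k l : Fin 7) : psi i j k l = -psi j i k l := by
  simp only [psi, eps_swap i j, neg_mul, Finset.sum_neg_distrib]; ring

theorem psi_swap_middle (i j k l : Fin 7) : psi i j k l = -psi i k j l := by
  rw [psi_cyclic_first i j, psi_swap_left]

theorem sum_eps_mul_eps_pair (k l : Fin 7) :
    ∑ i, ∑ j, eps i j k * eps i j l = 6 * delta k l := by
  revert k l
  simp only [eps_eq_ite, delta]
  decide +kernel

theorem sum_eps_mul_eps_mul_eps (m n q : Fin 7) :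
    ∑ i, ∑ j, ∑ k, eps m i j * eps n j k * eps q k i = -3 * eps m n q := by
  have h : ∀ i, ∑ j, ∑ k, eps m i j * eps n j k * eps q k i =
      crossSign m i * (crossSign n (crossIndex m i) *
        eps q (crossIndex n (crossIndex m i)) i) := fun i => by
    simp only [mul_assoc, ← Finset.mul_sum]
    simp only [sum_eps_mul]
  simp only [h]
  revert m n q
  simp only [eps_eq_ite]
  decide +kernel

/-- For each `m` there is one triple of indices for which the stabilizer equation, as a linear form
in the matrix, is a nonzero multiple of contraction with `ε_abm`. -/
theorem stabTerm_eq_eps (m a b : Fin 7) :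
    stabTerm a b (lineFst m 0) (lineFst m 1) (lineSnd m 2) =
      stabTerm (lineFst m 0) (lineSnd m 0) (lineFst m 0) (lineFst m 1) (lineSnd m 2) * eps a b m ∧
      stabTerm (lineFst m 0) (lineSnd m 0) (lineFst m 0) (lineFst m 1) (lineSnd m 2) ≠ 0 := by
  revert m a b
  simp only [stabTerm, eps_eq_ite]
  decide +kernel

/-! ### Matrices and the Lie algebra of `G_2` -/

/-- The matrix with entries `ε_mij` (rows `i`, columns `j`). -/
def crossMatrix (m : Fin 7) : Matrix (Fin 7) (Fin 7) ℝ := Matrix.of fun i j => (eps m i j : ℝ)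

theorem crossMatrix_apply (m i j : Fin 7) : crossMatrix m i j = eps m i j := rfl

theorem crossMatrix_transpose (m : Fin 7) : (crossMatrix m)ᵀ = -crossMatrix m := by
  ext i j
  simp [crossMatrix_apply, eps_swap_right m j i]

theorem trace_crossMatrix_mul (m : Fin 7) (A : Matrix (Fin 7) (Fin 7) ℝ) :
    (crossMatrix m * A).trace = -∑ i, ∑ j, (eps i j m : ℝ) * A i j := by
  simp only [Matrix.trace, Matrix.diag_apply, Matrix.mul_apply, crossMatrix_apply]
  rw [Finset.sum_comm, ← Finset.sum_neg_distrib]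
  refine Finset.sum_congr rfl fun i _ => ?_
  rw [← Finset.sum_neg_distrib]
  refine Finset.sum_congr rfl fun j _ => ?_
  rw [eps_cyclic m j i, eps_swap j i m]
  push_cast; ring

theorem trace_crossMatrix_mul_crossMatrix (m n : Fin 7) :
    (crossMatrix m * crossMatrix n).trace = if m = n then -6 else 0 := by
  rw [trace_crossMatrix_mul]
  have h := congrArg (Int.cast : ℤ → ℝ) (sum_eps_mul_eps_pair m n)
  simp only [crossMatrix_apply, eps_cyclic n]
  push_cast at h
  rw [h]
  simp only [delta]
  split_ifs <;> norm_num

theorem trace_crossMatrix_mul_mul (m n q : Fin 7) :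
    (crossMatrix m * crossMatrix n * crossMatrix q).trace = -3 * (eps m n q : ℝ) := by
  have h := congrArg (Int.cast : ℤ → ℝ) (sum_eps_mul_eps_mul_eps m n q)
  push_cast at h
  rw [← h]
  simp only [Matrix.trace, Matrix.diag_apply, Matrix.mul_apply, crossMatrix_apply, Finset.sum_mul]
  exact Finset.sum_congr rfl fun i _ => Finset.sum_comm

/-- An element of the Lie algebra of `G_2` is orthogonal to every `ε_ijm`. -/
theorem sum_eps_mul_of_mem_g2 {a : MatSpace} (ha : a ∈ g2) (m : Fin 7) :
    ∑ i, ∑ j, (eps i j m : ℝ) * a (i, j) = 0 := by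
  obtain ⟨hs, h⟩ := ha
  have hs : ∀ i j, a (j, i) = -a (i, j) := hs
  have hstab : ∀ i j k, ∑ p, ∑ q, (stabTerm p q i j k : ℝ) * a (p, q) = 0 := by
    intro i j k
    have h1 : ∀ p q, (stabTerm p q i j k : ℝ) * a (p, q) =
        ((if q = i then a (p, q) * eps p j k else 0) + (if q = j then a (p, q) * eps i p k else 0)
          + (if q = k then a (p, q) * eps i j p else 0))
        + ((if p = i then a (q, p) * eps q j k else 0) + (if p = j then a (q, p) * eps i q k else 0)
          + (if p = k then a (q, p) * eps i j q else 0)) := by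
      intro p q
      simp only [stabTerm, hs p q, eq_comm (a := p), eq_comm (a := q)]
      push_cast
      split_ifs <;> ring
    simp only [h1, Finset.sum_add_distrib]
    have h2 := h i j k
    simp only [Finset.sum_add_distrib] at h2
    simp [Finset.sum_ite_eq']
    linarith
  have hm := hstab (lineFst m 0) (lineFst m 1) (lineSnd m 2)
  -- One well-chosen stabilizer equation is a nonzero multiple of the required relation.
  have hc : (stabTerm (lineFst m 0) (lineSnd m 0) (lineFst m 0) (lineFst m 1) (lineSnd m 2) : ℝ) ≠
      0 := by
    exact_mod_cast (stabTerm_eq_eps m 0 0).2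
  refine (mul_eq_zero.1 (?_ : _ * _ = (0 : ℝ))).resolve_left hc
  rw [← hm, Finset.mul_sum]
  refine Finset.sum_congr rfl fun i _ => ?_
  rw [Finset.mul_sum]
  refine Finset.sum_congr rfl fun j _ => ?_
  rw [(stabTerm_eq_eps m i j).1]
  push_cast; ring

/-- The matrix with entries `∑_m ε_ijm c_m`, i.e. the element of `𝔤₂^⊥` given by the vector `c`. -/
noncomputable def epsVec (c : Fin 7 → ℝ) : MatSpace :=
  WithLp.toLp 2 fun p => ∑ m, (eps p.1 p.2 m : ℝ) * c m

theorem inner_epsVec (c : Fin 7 → ℝ) (a : MatSpace) :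
    inner ℝ a (epsVec c) = ∑ m, c m * ∑ i, ∑ j, (eps i j m : ℝ) * a (i, j) := by
  simp only [PiLp.inner_apply, Fintype.sum_prod_type, epsVec, RCLike.inner_apply, conj_trivial,
    Finset.sum_mul, Finset.mul_sum]
  rw [Finset.sum_congr rfl fun i _ => Finset.sum_comm, Finset.sum_comm]
  refine Finset.sum_congr rfl fun m _ => Finset.sum_congr rfl fun i _ =>
    Finset.sum_congr rfl fun j _ => ?_
  ring

theorem epsVec_mem_g2Perp (c : Fin 7 → ℝ) : epsVec c ∈ g2Perp := by
  refine ⟨fun i j => ?_, fun a ha => ?_⟩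
  · simp [epsVec, eps_swap j i]
  · rw [inner_epsVec]
    simp [sum_eps_mul_of_mem_g2 ha]

theorem exists_eq_epsVec {z : MatSpace} (hz : z ∈ g2Perp) : ∃ c, z = epsVec c := by
  refine ⟨fun k => z (lineFst k 0, lineSnd k 0), ?_⟩
  ext p
  exact apply_of_mem_g2Perp hz p.1 p.2

theorem sum_eps_mul_epsVec (c : Fin 7 → ℝ) (m : Fin 7) :
    ∑ i, ∑ j, (eps i j m : ℝ) * epsVec c (i, j) = 6 * c m := by
  have h : ∀ n, ∑ i, ∑ j, (eps i j m : ℝ) * eps i j n = if m = n then 6 else 0 := fun n => by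
    have h := congrArg (Int.cast : ℤ → ℝ) (sum_eps_mul_eps_pair m n)
    push_cast at h
    rw [h, delta]; split_ifs <;> norm_num
  have h2 : ∑ i, ∑ j, (eps i j m : ℝ) * epsVec c (i, j) =
      ∑ n, c n * ∑ i, ∑ j, (eps i j m : ℝ) * eps i j n := by
    simp only [epsVec, Finset.mul_sum]
    rw [Finset.sum_congr rfl fun i _ => Finset.sum_comm, Finset.sum_comm]
    refine Finset.sum_congr rfl fun m _ => Finset.sum_congr rfl fun i _ =>
      Finset.sum_congr rfl fun j _ => ?_
    ring
  rw [h2]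
  simp only [h]
  simp [mul_comm]

/-- The orthogonal projection onto `𝔤₂^⊥` is contraction with `ε`, up to the factor `1/6`. -/
theorem starProjection_g2Perp (a : MatSpace) :
    g2Perp.starProjection a =
      epsVec fun m => (1 / 6 : ℝ) * ∑ i, ∑ j, (eps i j m : ℝ) * a (i, j) := by
  refine Submodule.eq_starProjection_of_mem_of_inner_eq_zero (epsVec_mem_g2Perp _) fun w hw => ?_
  obtain ⟨c, rfl⟩ := exists_eq_epsVec hw
  rw [inner_sub_left, inner_epsVec, inner_epsVec]
  simp only [sum_eps_mul_epsVec]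
  rw [← Finset.sum_sub_distrib]
  exact Finset.sum_eq_zero fun m _ => by ring

/-- The Lie algebra of `G_2` consists of the skew-symmetric matrices orthogonal to every `ε_ijm`. -/
theorem mem_g2_of_sum_eps_mul {a : MatSpace} (hs : a ∈ so7)
    (h : ∀ m, ∑ i, ∑ j, (eps i j m : ℝ) * a (i, j) = 0) : a ∈ g2 := by
  have hp : g2.starProjection a ∈ g2 := g2.starProjection_apply_mem a
  have hq : a - g2.starProjection a ∈ g2Perp :=
    ⟨so7.sub_mem hs hp.1, g2.sub_starProjection_mem_orthogonal a⟩
  obtain ⟨c, hc⟩ := exists_eq_epsVec hq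
  have hc0 : ∀ m, c m = 0 := by
    intro m
    have h1 := sum_eps_mul_epsVec c m
    rw [← hc] at h1
    simp only [PiLp.sub_apply, mul_sub, Finset.sum_sub_distrib, h m,
      sum_eps_mul_of_mem_g2 hp m] at h1
    linarith
  have h0 : a - g2.starProjection a = 0 := by
    rw [hc]
    ext p
    simp [epsVec, hc0]
  rw [sub_eq_zero.1 h0]
  exact hp

/-- Infinitesimal invariance of the cross product under the Lie algebra of `G_2`. -/
theorem commutator_crossMatrix {A : Matrix (Fin 7) (Fin 7) ℝ} (hA : Aᵀ = -A)
    (h : ∀ m, (crossMatrix m * A).trace = 0) (m : Fin 7) :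
    A * crossMatrix m - crossMatrix m * A = ∑ l, A l m • crossMatrix l := by
  have hs : ∀ i j, A j i = -A i j := fun i j => congrFun (congrFun hA i) j
  let a : MatSpace := WithLp.toLp 2 fun p => A p.1 p.2
  have ha : a ∈ g2 := by
    refine mem_g2_of_sum_eps_mul (fun i j => hs i j) fun m => ?_
    have h1 := h m
    rw [trace_crossMatrix_mul] at h1
    simpa [a] using h1
  ext j k
  have h1 : ∑ l, (A l m * eps l j k + A l j * eps m l k + A l k * eps m j l) = 0 := ha.2 m j k
  simp only [Matrix.sub_apply, Matrix.mul_apply, Matrix.sum_apply, Matrix.smul_apply, smul_eq_mul,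
    crossMatrix_apply]
  simp only [Finset.sum_add_distrib] at h1
  have h2 : ∑ l, A l j * (eps m l k : ℝ) = -∑ l, A j l * (eps m l k : ℝ) := by
    rw [← Finset.sum_neg_distrib]
    exact Finset.sum_congr rfl fun l _ => by rw [hs j l]; ring
  simp only [mul_comm (eps m j _ : ℝ)]
  linarith

/-! ### Contractions of the curvature matrices with the standard 3-form -/

theorem sum_eps_mul_eps_real (i j k l : Fin 7) :
    ∑ m, (eps i j m : ℝ) * eps k l m = (if i = k then (if j = l then 1 else 0) else 0)
      - (if i = l then (if j = k then 1 else 0) else 0) + psi i j k l := by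
  have h := congrArg (Int.cast : ℤ → ℝ) (sum_eps_mul_eps i j k l)
  push_cast [delta] at h
  rw [h]
  simp only [ite_mul, one_mul, zero_mul]

/-- The quadratic form `∑ ε_nqm ε_abm T_na T_qb`, which is `i_0(T)` in an adapted basis. -/
noncomputable def crossForm (T : Matrix (Fin 7) (Fin 7) ℝ) : ℝ :=
  ∑ a, ∑ b, ∑ n, ∑ q, T n a * T q b * ∑ m, (eps n q m : ℝ) * eps a b m

/-- The quadratic form `∑ ψ_nqab T_na T_qb`. -/
noncomputable def psiForm (T : Matrix (Fin 7) (Fin 7) ℝ) : ℝ :=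
  ∑ a, ∑ b, ∑ n, ∑ q, T n a * T q b * psi n q a b

theorem trace_mul_self_eq (T : Matrix (Fin 7) (Fin 7) ℝ) :
    (T * T).trace = ∑ a, ∑ b, T a b * T b a := by
  simp only [Matrix.trace, Matrix.diag_apply, Matrix.mul_apply]

theorem crossForm_eq (T : Matrix (Fin 7) (Fin 7) ℝ) :
    crossForm T = T.trace ^ 2 - (T * T).trace + psiForm T := by
  simp only [crossForm, psiForm, sum_eps_mul_eps_real, mul_add, mul_sub, Finset.sum_add_distrib,
    Finset.sum_sub_distrib]
  rw [trace_mul_self_eq]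
  simp [Matrix.trace, sq, Finset.sum_mul_sum]
  exact Finset.sum_congr rfl fun a _ => Finset.sum_congr rfl fun b _ => mul_comm _ _

/-- The squared norm of a matrix whose contraction with `ε` vanishes. -/
theorem sum_sq_eq {T : Matrix (Fin 7) (Fin 7) ℝ}
    (hw : ∀ m, (crossMatrix m * T).trace = 0) :
    ∑ a, ∑ n, T n a * T n a = (T * T).trace + psiForm T := by
  have h : ∑ m, (∑ n, ∑ a, (eps n a m : ℝ) * T n a) * (∑ q, ∑ b, (eps q b m : ℝ) * T q b) = 0 :=
    Finset.sum_eq_zero fun m _ => by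
      have h1 := hw m
      rw [trace_crossMatrix_mul] at h1
      rw [neg_eq_zero.1 h1, zero_mul]
  have h2 : ∑ m, (∑ n, ∑ a, (eps n a m : ℝ) * T n a) * (∑ q, ∑ b, (eps q b m : ℝ) * T q b) =
      ∑ a, ∑ b, ∑ n, ∑ q, T n a * T q b * ∑ m, (eps n a m : ℝ) * eps q b m := by
    have h3 : ∀ m, (∑ n, ∑ a, (eps n a m : ℝ) * T n a) * (∑ q, ∑ b, (eps q b m : ℝ) * T q b) =
        ∑ a, ∑ b, ∑ n, ∑ q, T n a * T q b * ((eps n a m : ℝ) * eps q b m) := fun m => by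
      rw [Finset.sum_comm, Finset.sum_mul_sum]
      refine Finset.sum_congr rfl fun a _ => Finset.sum_congr rfl fun b _ => ?_
      rw [Finset.sum_mul_sum]
      refine Finset.sum_congr rfl fun n _ => Finset.sum_congr rfl fun q _ => ?_
      ring
    simp only [h3, Finset.mul_sum]
    rw [Finset.sum_comm]; refine Finset.sum_congr rfl fun a _ => ?_
    rw [Finset.sum_comm]; refine Finset.sum_congr rfl fun b _ => ?_
    rw [Finset.sum_comm]; refine Finset.sum_congr rfl fun n _ => ?_
    rw [Finset.sum_comm]
  have h4 : ∑ a, ∑ b, ∑ n, ∑ q, T n a * T q b * (psi n a q b : ℝ) = -psiForm T := by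
    simp only [psiForm, ← Finset.sum_neg_distrib]
    refine Finset.sum_congr rfl fun a _ => Finset.sum_congr rfl fun b _ =>
      Finset.sum_congr rfl fun n _ => Finset.sum_congr rfl fun q _ => ?_
    rw [psi_swap_middle n a q b]; push_cast; ring
  rw [h2] at h
  simp only [sum_eps_mul_eps_real, mul_add, mul_sub, Finset.sum_add_distrib,
    Finset.sum_sub_distrib, h4] at h
  rw [trace_mul_self_eq]
  simp at h
  rw [Finset.sum_comm (f := fun a b => T a b * T b a)]
  linarith

theorem sum_trace_crossMatrix_mul {T : Matrix (Fin 7) (Fin 7) ℝ}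
    (hw : ∀ m, (crossMatrix m * T).trace = 0) :
    ∑ a, ∑ n, T n a * (crossMatrix a * T * crossMatrix n).trace =
      2 * crossForm T + 3 * (T * T).trace - 3 * T.trace ^ 2 := by
  have h1 : ∀ a n, (crossMatrix a * T * crossMatrix n).trace =
      ∑ m, ∑ i, T m i * ∑ b, (eps m a b : ℝ) * eps n i b := fun a n => by
    rw [Matrix.trace]
    simp only [Matrix.diag_apply, Matrix.mul_apply, crossMatrix_apply, Finset.mul_sum,
      Finset.sum_mul]
    rw [Finset.sum_congr rfl fun b _ => Finset.sum_comm, Finset.sum_comm]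
    refine Finset.sum_congr rfl fun m _ => ?_
    rw [Finset.sum_comm]
    refine Finset.sum_congr rfl fun i _ => Finset.sum_congr rfl fun b _ => ?_
    rw [eps_cyclic m a b]
    ring
  have h5 : ∑ a, ∑ n, ∑ q, ∑ b, T n a * (T q b * (psi q a n b : ℝ)) = psiForm T := by
    rw [psiForm]
    refine Finset.sum_congr rfl fun a _ => ?_
    calc ∑ n, ∑ q, ∑ b, T n a * (T q b * (psi q a n b : ℝ))
        = ∑ n, ∑ b, ∑ q, T n a * T q b * psi n q a b := by
          refine Finset.sum_congr rfl fun n _ => ?_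
          rw [Finset.sum_comm]
          refine Finset.sum_congr rfl fun b _ => Finset.sum_congr rfl fun q _ => ?_
          rw [psi_cyclic_first q a n b, mul_assoc]
      _ = _ := Finset.sum_comm
  have h6 := sum_sq_eq hw
  simp only [h1, sum_eps_mul_eps_real, mul_add, mul_sub, Finset.sum_add_distrib,
    Finset.sum_sub_distrib, Finset.mul_sum]
  rw [h5, crossForm_eq]
  have h7 : T.trace ^ 2 = ∑ a, ∑ n, T a a * T n n := by
    simp only [Matrix.trace, sq, Finset.sum_mul_sum, Matrix.diag_apply]
  simp
  linarith

theorem sum_eps_mul_swap (f : Fin 7 → Fin 7 → Fin 7 → ℝ) :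
    ∑ m, ∑ a, ∑ b, (eps a b m : ℝ) * f m b a = -∑ m, ∑ a, ∑ b, (eps a b m : ℝ) * f m a b := by
  rw [← Finset.sum_neg_distrib]
  refine Finset.sum_congr rfl fun m _ => ?_
  rw [Finset.sum_comm, ← Finset.sum_neg_distrib]
  refine Finset.sum_congr rfl fun a _ => ?_
  rw [← Finset.sum_neg_distrib]
  refine Finset.sum_congr rfl fun b _ => ?_
  rw [eps_swap b a]; push_cast; ring

/-- For skew matrices `G_a` whose projections to `𝔤₂^⊥` are given by `T`, the part of the curvature
contraction that is quadratic in the `G_a` depends on `T` only. -/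
theorem quadratic_contraction {G : Fin 7 → Matrix (Fin 7) (Fin 7) ℝ}
    {T : Matrix (Fin 7) (Fin 7) ℝ} (hG : ∀ a, (G a)ᵀ = -G a)
    (hT : ∀ m a, (crossMatrix m * G a).trace = 6 * T m a)
    (hw : ∀ m, (crossMatrix m * T).trace = 0) :
    12 * ∑ a, (crossMatrix a * T * G a).trace
      - 2 * ∑ m, ∑ a, ∑ b, (eps a b m : ℝ) * (crossMatrix m * G a * G b).trace =
    -18 * crossForm T + 36 * (T.trace ^ 2 - (T * T).trace) := by
  -- `G a = A a - C a` is the decomposition along `𝔤₂` and its complement.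
  let C : Fin 7 → Matrix (Fin 7) (Fin 7) ℝ := fun a => ∑ n, T n a • crossMatrix n
  let A : Fin 7 → Matrix (Fin 7) (Fin 7) ℝ := fun a => G a + C a
  have hGA : ∀ a, G a = A a - C a := fun a => by simp [A]
  have hAs : ∀ a, (A a)ᵀ = -A a := fun a => by
    simp [A, C, hG, Matrix.transpose_sum, crossMatrix_transpose, add_comm]
  have htrC : ∀ (X : Matrix (Fin 7) (Fin 7) ℝ) a, (X * C a).trace =
      ∑ n, T n a * (X * crossMatrix n).trace := fun X a => by
    simp [C, Matrix.mul_sum, Matrix.trace_sum]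
  have hA0 : ∀ a m, (crossMatrix m * A a).trace = 0 := fun a m => by
    simp only [A, Matrix.mul_add, Matrix.trace_add, hT, htrC, trace_crossMatrix_mul_crossMatrix]
    simp; ring
  have hcomm := fun a => commutator_crossMatrix (hAs a) (hA0 a)
  have h1 : ∑ m, ∑ a, ∑ b, (eps a b m : ℝ) * (crossMatrix m * A a * A b).trace = 0 := by
    have hsymm : ∀ m a b, (crossMatrix m * A a * A b).trace =
        (crossMatrix m * A b * A a).trace := by
      intro m a b
      have e1 : crossMatrix m * A a * A b = A a * crossMatrix m * A b
          - (∑ l, A a l m • crossMatrix l) * A b := by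
        rw [← hcomm a m]; noncomm_ring
      rw [e1, Matrix.trace_sub, Matrix.sum_mul, Matrix.trace_sum]
      simp only [Matrix.smul_mul, Matrix.trace_smul, hA0, smul_zero, Finset.sum_const_zero,
        sub_zero]
      rw [Matrix.mul_assoc, Matrix.trace_mul_comm]
    have e2 := sum_eps_mul_swap fun m a b => (crossMatrix m * A a * A b).trace
    simp only [fun m a b => hsymm m b a] at e2
    linarith
  have h2 : ∑ m, ∑ a, ∑ b, (eps a b m : ℝ) * (crossMatrix m * A a * C b).trace
      + ∑ m, ∑ a, ∑ b, (eps a b m : ℝ) * (crossMatrix m * C a * A b).trace =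
      -6 * ∑ a, (crossMatrix a * A a * T).trace := by
    have e1 := sum_eps_mul_swap fun m a b => (crossMatrix m * C b * A a).trace
    have e2 : ∀ m a b, (crossMatrix m * A a * C b).trace - (crossMatrix m * C b * A a).trace =
        -6 * (A a * T) m b := by
      intro m a b
      have e3 : A a * C b - C b * A a = ∑ n, T n b • ∑ l, A a l n • crossMatrix l := by
        simp only [C, Matrix.mul_sum, Matrix.sum_mul, ← Finset.sum_sub_distrib, Matrix.mul_smul,
          Matrix.smul_mul, ← smul_sub, hcomm]
      rw [← Matrix.trace_sub, Matrix.mul_assoc, Matrix.mul_assoc, ← Matrix.mul_sub, e3]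
      simp only [Matrix.mul_smul, Matrix.trace_sum, Matrix.trace_smul,
        trace_crossMatrix_mul_crossMatrix, Matrix.mul_apply, smul_eq_mul, mul_ite, mul_zero,
        Finset.sum_ite_eq, Finset.mem_univ, if_true, Finset.mul_sum]
      refine Finset.sum_congr rfl fun n _ => ?_
      ring
    have e4 : ∀ a, (crossMatrix a * A a * T).trace = ∑ b, ∑ m, (eps a b m : ℝ) * (A a * T) m b :=
      fun a => by
        rw [Matrix.mul_assoc]
        simp only [Matrix.trace, Matrix.diag_apply, Matrix.mul_apply (M := crossMatrix a),
          crossMatrix_apply]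
    rw [e1, ← sub_eq_add_neg, ← Finset.sum_sub_distrib]
    simp only [← Finset.sum_sub_distrib, ← mul_sub, e2, e4, Finset.mul_sum]
    rw [Finset.sum_comm]
    refine Finset.sum_congr rfl fun a _ => ?_
    rw [Finset.sum_comm]
    refine Finset.sum_congr rfl fun b _ => Finset.sum_congr rfl fun m _ => ?_
    ring
  have h3 : ∑ a, (crossMatrix a * T * A a).trace = ∑ a, (crossMatrix a * A a * T).trace := by
    have e1 : ∀ a, (crossMatrix a * T * A a).trace = (crossMatrix a * A a * T).trace := fun a => by
      have e2 : A a * crossMatrix a * T = crossMatrix a * A a * T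
          + (∑ l, A a l a • crossMatrix l) * T := by
        rw [← hcomm a a]; noncomm_ring
      rw [Matrix.trace_mul_comm, ← Matrix.mul_assoc, e2, Matrix.trace_add, Matrix.sum_mul,
        Matrix.trace_sum]
      simp [hw]
    simp only [e1]
  have h4 : ∑ m, ∑ a, ∑ b, (eps a b m : ℝ) * (crossMatrix m * C a * C b).trace =
      -3 * crossForm T := by
    have e1 : ∀ m a b, (crossMatrix m * C a * C b).trace =
        ∑ n, ∑ q, T n a * T q b * (-3 * eps n q m) := fun m a b => by
      simp only [C, Matrix.mul_sum, Matrix.sum_mul, Matrix.mul_smul, Matrix.smul_mul,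
        Matrix.trace_sum, Matrix.trace_smul, trace_crossMatrix_mul_mul, smul_eq_mul]
      rw [Finset.sum_comm]
      refine Finset.sum_congr rfl fun n _ => ?_
      rw [Finset.mul_sum]
      refine Finset.sum_congr rfl fun q _ => ?_
      rw [eps_cyclic m q n]; ring
    simp only [e1, crossForm, Finset.mul_sum]
    rw [Finset.sum_comm]; refine Finset.sum_congr rfl fun a _ => ?_
    rw [Finset.sum_comm]; refine Finset.sum_congr rfl fun b _ => ?_
    rw [Finset.sum_comm]; refine Finset.sum_congr rfl fun n _ => ?_
    rw [Finset.sum_comm]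
    refine Finset.sum_congr rfl fun q _ => Finset.sum_congr rfl fun m _ => ?_
    ring
  have h5 : ∑ a, (crossMatrix a * T * C a).trace =
      2 * crossForm T + 3 * (T * T).trace - 3 * T.trace ^ 2 := by
    rw [← sum_trace_crossMatrix_mul hw]
    simp only [htrC]
  simp only [hGA, Matrix.sub_mul, Matrix.trace_sub, Finset.sum_sub_distrib, mul_sub]
  rw [h1, h3, h5, h4]
  linarith

/-- The components `K_ab` of the curvature form of a connection with connection matrices `G_a` in a
frame whose structure functions are those of a torsion-free connection; `D_ab` stands for the
derivative of `G_b` along the `a`-th frame field. -/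
def curvatureMatrix (G : Fin 7 → Matrix (Fin 7) (Fin 7) ℝ)
    (D : Fin 7 → Fin 7 → Matrix (Fin 7) (Fin 7) ℝ) (a b : Fin 7) : Matrix (Fin 7) (Fin 7) ℝ :=
  D a b - D b a - ∑ i, (G a i b - G b i a) • G i + (G a * G b - G b * G a)

theorem curvatureMatrix_transpose {G : Fin 7 → Matrix (Fin 7) (Fin 7) ℝ}
    {D : Fin 7 → Fin 7 → Matrix (Fin 7) (Fin 7) ℝ} (hG : ∀ a, (G a)ᵀ = -G a)
    (hD : ∀ a b, (D a b)ᵀ = -D a b) (a b : Fin 7) :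
    (curvatureMatrix G D a b)ᵀ = -curvatureMatrix G D a b := by
  simp only [curvatureMatrix, Matrix.transpose_add, Matrix.transpose_sub, Matrix.transpose_sum,
    Matrix.transpose_smul, Matrix.transpose_mul, hG, hD, smul_neg, Finset.sum_neg_distrib,
    Matrix.neg_mul, Matrix.mul_neg]
  abel

/-- The first Bianchi identity turns the contraction of the curvature with `ε ε` into a multiple of
the scalar curvature. -/
theorem sum_eps_mul_trace {K : Fin 7 → Fin 7 → Matrix (Fin 7) (Fin 7) ℝ}
    (hK : ∀ a b, (K a b)ᵀ = -K a b)
    (hB : ∀ a b k l, K a b l k + K b k l a + K k a l b = 0) :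
    ∑ m, ∑ a, ∑ b, (eps a b m : ℝ) * (crossMatrix m * K a b).trace =
      -2 * ∑ a, ∑ b, K a b a b := by
  have hs : ∀ a b l k, K a b k l = -K a b l k := fun a b l k => congrFun (congrFun (hK a b) l) k
  have hpsi : ∑ a, ∑ b, ∑ l, ∑ k, K a b l k * (psi a b l k : ℝ) = 0 := by
    have e1 : ∀ f : Fin 7 → Fin 7 → Fin 7 → Fin 7 → ℝ,
        ∑ a, ∑ b, ∑ l, ∑ k, f a b l k = ∑ a, ∑ b, ∑ l, ∑ k, f b k l a := fun f => by
      calc ∑ a, ∑ b, ∑ l, ∑ k, f a b l k = ∑ a, ∑ b, ∑ k, ∑ l, f a b l k :=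
            Finset.sum_congr rfl fun a _ => Finset.sum_congr rfl fun b _ => Finset.sum_comm
        _ = ∑ a, ∑ k, ∑ b, ∑ l, f a b l k := Finset.sum_congr rfl fun a _ => Finset.sum_comm
        _ = ∑ k, ∑ a, ∑ b, ∑ l, f a b l k := Finset.sum_comm
        _ = _ := Finset.sum_congr rfl fun a _ => Finset.sum_congr rfl fun b _ => Finset.sum_comm
    have e2 := e1 fun a b l k => K a b l k * (psi a b l k : ℝ)
    have e3 := e1 fun a b l k => K b k l a * (psi b k l a : ℝ)
    have e4 : ∑ a, ∑ b, ∑ l, ∑ k, K a b l k * (psi a b l k : ℝ)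
        + ∑ a, ∑ b, ∑ l, ∑ k, K b k l a * (psi b k l a : ℝ)
        + ∑ a, ∑ b, ∑ l, ∑ k, K k a l b * (psi k a l b : ℝ) = 0 := by
      simp only [← Finset.sum_add_distrib]
      refine Finset.sum_eq_zero fun a _ => Finset.sum_eq_zero fun b _ =>
        Finset.sum_eq_zero fun l _ => Finset.sum_eq_zero fun k _ => ?_
      rw [← psi_cyclic b k a l, ← psi_cyclic a b k l]
      linear_combination (psi a b l k : ℝ) * hB a b k l
    linarith
  have e5 : ∑ m, ∑ a, ∑ b, (eps a b m : ℝ) * (crossMatrix m * K a b).trace =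
      -∑ a, ∑ b, ∑ l, ∑ k, K a b l k * ∑ m, (eps a b m : ℝ) * eps l k m := by
    simp only [trace_crossMatrix_mul, mul_neg, Finset.sum_neg_distrib, Finset.mul_sum]
    rw [neg_inj]
    rw [Finset.sum_comm]; refine Finset.sum_congr rfl fun a _ => ?_
    rw [Finset.sum_comm]; refine Finset.sum_congr rfl fun b _ => ?_
    rw [Finset.sum_comm]; refine Finset.sum_congr rfl fun l _ => ?_
    rw [Finset.sum_comm]
    refine Finset.sum_congr rfl fun k _ => Finset.sum_congr rfl fun m _ => ?_
    ring
  rw [e5]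
  simp only [sum_eps_mul_eps_real, mul_add, mul_sub, Finset.sum_add_distrib,
    Finset.sum_sub_distrib, hpsi]
  simp
  have e6 : ∑ a, ∑ b, K a b b a = -∑ a, ∑ b, K a b a b := by
    simp only [← Finset.sum_neg_distrib]
    exact Finset.sum_congr rfl fun a _ => Finset.sum_congr rfl fun b _ => hs a b a b
  rw [e6]
  ring

/-- The scalar curvature of an adapted frame, in terms of the torsion matrix `T`; the hypothesis
`hdiv` says that the divergence of the characteristic vector field vanishes. -/
theorem sum_curvatureMatrix {G : Fin 7 → Matrix (Fin 7) (Fin 7) ℝ}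
    {D : Fin 7 → Fin 7 → Matrix (Fin 7) (Fin 7) ℝ} {T : Matrix (Fin 7) (Fin 7) ℝ}
    (hG : ∀ a, (G a)ᵀ = -G a) (hD : ∀ a b, (D a b)ᵀ = -D a b)
    (hB : ∀ a b k l, curvatureMatrix G D a b l k + curvatureMatrix G D b k l a
      + curvatureMatrix G D k a l b = 0)
    (hT : ∀ m a, (crossMatrix m * G a).trace = 6 * T m a)
    (hw : ∀ m, (crossMatrix m * T).trace = 0)
    (hdiv : ∑ m, ∑ a, ∑ b, (eps a b m : ℝ) * (crossMatrix m * D a b).trace = 0) :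
    ∑ a, ∑ b, curvatureMatrix G D a b a b =
      -9 * crossForm T + 18 * (T.trace ^ 2 - (T * T).trace) := by
  have h1 := sum_eps_mul_trace (curvatureMatrix_transpose hG hD) hB
  have h2 := quadratic_contraction hG hT hw
  have h3 := sum_eps_mul_swap fun m a b => (crossMatrix m * D a b).trace
  have h4 := sum_eps_mul_swap fun m a b => (crossMatrix m * G a * G b).trace
  have h5 := sum_eps_mul_swap fun m a b => ∑ i, G a i b * (6 * T m i)
  have h6 : ∑ m, ∑ a, ∑ b, (eps a b m : ℝ) * ∑ i, G a i b * (6 * T m i) =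
      6 * ∑ a, (crossMatrix a * T * G a).trace := by
    simp only [Matrix.trace, Matrix.diag_apply, Matrix.mul_apply, Finset.mul_sum, Finset.sum_mul,
      crossMatrix_apply]
    rw [Finset.sum_comm]
    refine Finset.sum_congr rfl fun a _ => ?_
    rw [Finset.sum_comm]
    refine Finset.sum_congr rfl fun b _ => ?_
    rw [Finset.sum_comm]
    refine Finset.sum_congr rfl fun i _ => Finset.sum_congr rfl fun m _ => ?_
    ring
  have h7 : ∑ m, ∑ a, ∑ b, (eps a b m : ℝ) * (crossMatrix m * curvatureMatrix G D a b).trace =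
      -12 * ∑ a, (crossMatrix a * T * G a).trace
      + 2 * ∑ m, ∑ a, ∑ b, (eps a b m : ℝ) * (crossMatrix m * G a * G b).trace := by
    simp only [curvatureMatrix, Matrix.mul_sum, Matrix.mul_smul,
      Matrix.trace_add, Matrix.trace_sub, Matrix.trace_sum, Matrix.trace_smul, smul_eq_mul, hT,
      sub_mul, mul_add, mul_sub, Finset.sum_add_distrib, Finset.sum_sub_distrib,
      ← Matrix.mul_assoc]
    rw [h3, h4, h5, h6, hdiv]
    ring
  linarith

/-! ### Calculus in an orthonormal frame -/

section FrameCalculus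

variable {E : Type*} [NormedAddCommGroup E] [NormedSpace ℝ E] [FiniteDimensional ℝ E]
  {H : Type*} [TopologicalSpace H] {I : ModelWithCorners ℝ E H}
  {M : Type*} [TopologicalSpace M] [ChartedSpace H M] [IsManifold I ∞ M]
  [RiemannianBundle (fun x : M => TangentSpace I x)]
  [IsContMDiffRiemannianBundle I ∞ E (fun x : M => TangentSpace I x)]
  {ι : Type} [Fintype ι] [DecidableEq ι]

theorem mvfderiv_congr_of_eventuallyEq {f g : M → ℝ} {x : M} (h : f =ᶠ[𝓝 x] g) :
    mvfderiv I f x = mvfderiv I g x := by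
  ext v
  simp only [mvfderiv, h.mfderiv_eq, ContinuousLinearMap.comp_apply]
  rw [h.self_of_nhds]
  rfl

theorem mvfderiv_eq_zero_of_eventuallyEq_const {f : M → ℝ} {x : M} {c : ℝ}
    (h : f =ᶠ[𝓝 x] fun _ => c) : mvfderiv I f x = 0 := by
  rw [mvfderiv_congr_of_eventuallyEq h, mvfderiv_const]

theorem mvfderiv_sum {κ : Type} (s : Finset κ) {f : κ → M → ℝ} {x : M}
    (hf : ∀ i ∈ s, MDiffAt (f i) x) :
    mvfderiv I (fun y => ∑ i ∈ s, f i y) x = ∑ i ∈ s, mvfderiv I (f i) x := by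
  classical
  induction s using Finset.induction_on with
  | empty => simpa using mvfderiv_const (I := I) (0 : ℝ) (x := x)
  | insert a s ha ih =>
    simp only [Finset.mem_insert, forall_eq_or_imp] at hf
    have hs : MDiffAt (fun y => ∑ i ∈ s, f i y) x := by
      have := MDifferentiableAt.sum (I := I) (E' := ℝ) (t := s) (f := f) hf.2
      convert this using 1
      ext y; simp
    simp only [Finset.sum_insert ha]
    rw [mvfderiv_fun_add hf.1 hs, ih hf.2]

/-- A smooth orthonormal frame of the tangent bundle on an open set. -/
structure IsOrthonormalFrameOn (I : ModelWithCorners ℝ E H) {M : Type*} [TopologicalSpace M]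
    [ChartedSpace H M] [IsManifold I ∞ M] [RiemannianBundle (fun x : M => TangentSpace I x)]
    (e : ι → Π x : M, TangentSpace I x) (U : Set M) : Prop where
  isOpen : IsOpen U
  smooth : ∀ i, ∀ y ∈ U, CMDiffAt ∞ (T% (e i)) y
  orthonormal : ∀ y ∈ U, Orthonormal ℝ (fun i => e i y)
  card_eq : Fintype.card ι = Module.finrank ℝ E

theorem IsOrthonormalFrameOn.mono {e : ι → Π x : M, TangentSpace I x} {U U' : Set M}
    (h : IsOrthonormalFrameOn I e U) (hU' : IsOpen U') (hs : U' ⊆ U) :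
    IsOrthonormalFrameOn I e U' :=
  ⟨hU', fun i y hy => h.smooth i y (hs hy), fun y hy => h.orthonormal y (hs hy), h.card_eq⟩

/-- The Lie bracket of smooth vector fields is smooth. -/
theorem contMDiffAt_mlieBracket {V W : Π x : M, TangentSpace I x} {y : M}
    (hV : CMDiffAt ∞ (T% V) y) (hW : CMDiffAt ∞ (T% W) y) :
    CMDiffAt ∞ (T% (mlieBracket I V W)) y := by
  have : IsManifold I (((⊤ : ℕ∞) : ℕ∞ω) + 1) M := ‹IsManifold I ∞ M›
  have : IsManifold I (minSmoothness ℝ 2) M := by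
    rw [minSmoothness_of_isRCLikeNormedField]; infer_instance
  exact ContMDiffAt.mlieBracket_vectorField (m := ⊤) (n := ⊤) hV hW (by simp)

theorem contMDiffAt_inner {V W : Π x : M, TangentSpace I x} {y : M}
    (hV : CMDiffAt ∞ (T% V) y) (hW : CMDiffAt ∞ (T% W) y) :
    CMDiffAt ∞ (fun z => (inner ℝ (V z) (W z) : ℝ)) y :=
  ContMDiffAt.inner_bundle (IB := I) (F := E) (E := fun x : M => TangentSpace I x)
    (b := fun z => z) hV hW

theorem leviCivita_bracket {V W : Π x : M, TangentSpace I x} {y : M}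
    (hV : MDiffAt (T% V) y) (hW : MDiffAt (T% W) y) :
    mlieBracket I V W y = leviCivita I M W y (V y) - leviCivita I M V y (W y) := by
  have h := (leviCivita I M).torsion_eq_zero_iff.1 (leviCivita_torsion (I := I) (M := M)) hV hW
  exact h.symm

namespace IsOrthonormalFrameOn

variable {e : ι → Π x : M, TangentSpace I x} {U : Set M}

theorem mem_nhds (h : IsOrthonormalFrameOn I e U) {y : M} (hy : y ∈ U) : U ∈ 𝓝 y :=
  h.isOpen.mem_nhds hy

theorem mdifferentiableAt (h : IsOrthonormalFrameOn I e U) {y : M} (hy : y ∈ U) (i : ι) :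
    MDiffAt (T% (e i)) y :=
  (h.smooth i y hy).mdifferentiableAt (by simp)

theorem inner_eq (h : IsOrthonormalFrameOn I e U) {y : M} (hy : y ∈ U) (i j : ι) :
    (inner ℝ (e i y) (e j y) : ℝ) = if i = j then 1 else 0 :=
  orthonormal_iff_ite.1 (h.orthonormal y hy) i j

theorem exists_orthonormalBasis (h : IsOrthonormalFrameOn I e U) {y : M} (hy : y ∈ U) :
    ∃ b : OrthonormalBasis ι ℝ (TangentSpace I y), ∀ i, b i = e i y := by
  have hc : Fintype.card ι = Module.finrank ℝ (TangentSpace I y) := h.card_eq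
  refine ⟨OrthonormalBasis.mk (h.orthonormal y hy) ?_, fun i => by rw [OrthonormalBasis.coe_mk]⟩
  rw [(h.orthonormal y hy).linearIndependent.span_eq_top_of_card_eq_finrank' hc]

theorem sum_inner_smul (h : IsOrthonormalFrameOn I e U) {y : M} (hy : y ∈ U)
    (v : TangentSpace I y) :
    ∑ i, (inner ℝ v (e i y) : ℝ) • e i y = v := by
  obtain ⟨b, hb⟩ := h.exists_orthonormalBasis hy
  simp only [← hb]
  conv_rhs => rw [← b.sum_repr' v]
  exact Finset.sum_congr rfl fun i _ => by rw [real_inner_comm]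

theorem inner_eq_sum (h : IsOrthonormalFrameOn I e U) {y : M} (hy : y ∈ U)
    (v w : TangentSpace I y) :
    (inner ℝ v w : ℝ) = ∑ i, (inner ℝ v (e i y) : ℝ) * inner ℝ w (e i y) := by
  conv_lhs => rw [← h.sum_inner_smul hy v]
  rw [sum_inner]
  exact Finset.sum_congr rfl fun i _ => by rw [real_inner_smul_left, real_inner_comm w]

/-- A vector field with smooth components in the frame is smooth. -/
theorem smooth_of_inner (h : IsOrthonormalFrameOn I e U) {V : Π x : M, TangentSpace I x}
    (hV : ∀ i, ∀ y ∈ U, CMDiffAt ∞ (fun z => (inner ℝ (V z) (e i z) : ℝ)) y) {y : M} (hy : y ∈ U) :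
    CMDiffAt ∞ (T% V) y := by
  have h1 : CMDiffAt ∞ (T% (fun z => ∑ i, ((fun z => (inner ℝ (V z) (e i z) : ℝ)) • e i) z)) y :=
    ContMDiffAt.sum_section fun i _ => (hV i y hy).smul_section (h.smooth i y hy)
  refine h1.congr_of_eventuallyEq ?_
  filter_upwards [h.mem_nhds hy] with z hz
  have := h.sum_inner_smul hz (V z)
  simp only [Pi.smul_apply', this]

/-- The derivative of a smooth function along a smooth vector field is smooth. -/
theorem contMDiffAt_mvfderiv (h : IsOrthonormalFrameOn I e U) [Nonempty ι] {f : M → ℝ}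
    {V : Π x : M, TangentSpace I x}
    (hf : ∀ y ∈ U, CMDiffAt ∞ f y) (hV : ∀ y ∈ U, CMDiffAt ∞ (T% V) y) {y : M} (hy : y ∈ U) :
    CMDiffAt ∞ (fun z => mvfderiv I f z (V z)) y := by
  let i : ι := Classical.arbitrary ι
  -- The identity `[V, f e_i] = (V f) e_i + f [V, e_i]` expresses `V f` through brackets of smooth
  -- fields.
  have h1 : CMDiffAt ∞ (fun z => (inner ℝ (mlieBracket I V (f • e i) z) (e i z) : ℝ)
      - f z * inner ℝ (mlieBracket I V (e i) z) (e i z)) y := by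
    refine ContMDiffAt.sub ?_ (ContMDiffAt.mul (hf y hy) ?_)
    · exact contMDiffAt_inner (contMDiffAt_mlieBracket (hV y hy)
        ((hf y hy).smul_section (h.smooth i y hy))) (h.smooth i y hy)
    · exact contMDiffAt_inner (contMDiffAt_mlieBracket (hV y hy) (h.smooth i y hy))
        (h.smooth i y hy)
  refine h1.congr_of_eventuallyEq ?_
  filter_upwards [h.mem_nhds hy] with z hz
  rw [mlieBracket_smul_right ((hf z hz).mdifferentiableAt (by simp)) (h.mdifferentiableAt hz i),
    inner_add_left, real_inner_smul_left, real_inner_smul_left, h.inner_eq hz]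
  simp

/-- The Lie bracket is the commutator of derivations. It follows from the Jacobi identity applied
to `V`, `W` and `f e_i`. -/
theorem mvfderiv_mlieBracket (h : IsOrthonormalFrameOn I e U) [Nonempty ι] {f : M → ℝ}
    {V W : Π x : M, TangentSpace I x}
    (hf : ∀ y ∈ U, CMDiffAt ∞ f y) (hV : ∀ y ∈ U, CMDiffAt ∞ (T% V) y)
    (hW : ∀ y ∈ U, CMDiffAt ∞ (T% W) y) {y : M} (hy : y ∈ U) :
    mvfderiv I f y (mlieBracket I V W y) =
      mvfderiv I (fun z => mvfderiv I f z (W z)) y (V y)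
        - mvfderiv I (fun z => mvfderiv I f z (V z)) y (W y) := by
  let i : ι := Classical.arbitrary ι
  have : IsManifold I (minSmoothness ℝ 3) M := by
    rw [minSmoothness_of_isRCLikeNormedField]
    infer_instance
  have hle : minSmoothness ℝ 2 ≤ (∞ : ℕ∞ω) := by
    rw [minSmoothness_of_isRCLikeNormedField]; exact ENat.LEInfty.out
  have hd : ∀ {g : M → ℝ} {z : M}, CMDiffAt ∞ g z → MDiffAt g z := fun hg =>
    hg.mdifferentiableAt (by simp)
  have hds : ∀ {Z : Π x : M, TangentSpace I x} {z : M}, CMDiffAt ∞ (T% Z) z → MDiffAt (T% Z) z :=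
    fun hg => hg.mdifferentiableAt (by simp)
  have hei := h.smooth i
  have key : ∀ {V W : Π x : M, TangentSpace I x}, (∀ y ∈ U, CMDiffAt ∞ (T% V) y) →
      (∀ y ∈ U, CMDiffAt ∞ (T% W) y) →
      mlieBracket I V (mlieBracket I W (f • e i)) y =
        mvfderiv I (fun z => mvfderiv I f z (W z)) y (V y) • e i y
          + mvfderiv I f y (W y) • mlieBracket I V (e i) y
          + (mvfderiv I f y (V y) • mlieBracket I W (e i) y
            + f y • mlieBracket I V (mlieBracket I W (e i)) y) := by
    intro V W hV hW
    have h1 : mlieBracket I W (f • e i) =ᶠ[𝓝 y]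
        ((fun z => mvfderiv I f z (W z)) • e i + f • mlieBracket I W (e i)) := by
      filter_upwards [h.mem_nhds hy] with z hz
      rw [mlieBracket_smul_right (hd (hf z hz)) (hds (hei z hz))]
      rfl
    have h2 := h.contMDiffAt_mvfderiv hf hW hy
    have h3 := contMDiffAt_mlieBracket (hW y hy) (hei y hy)
    rw [Filter.EventuallyEq.mlieBracket_vectorField_eq (Filter.EventuallyEq.refl _ V) h1,
      mlieBracket_add_right (hds (h2.smul_section (hei y hy)))
        (hds ((hf y hy).smul_section h3)),
      mlieBracket_smul_right (hd h2) (hds (hei y hy)),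
      mlieBracket_smul_right (hd (hf y hy)) (hds h3)]
  have hJ := leibniz_identity_mlieBracket_apply (I := I) (x := y) ((hV y hy).of_le hle)
    ((hW y hy).of_le hle) (((hf y hy).smul_section (hei y hy)).of_le hle)
  have hJ' := leibniz_identity_mlieBracket_apply (I := I) (x := y) ((hV y hy).of_le hle)
    ((hW y hy).of_le hle) ((hei y hy).of_le hle)
  rw [key hV hW, key hW hV, mlieBracket_smul_right (hd (hf y hy)) (hds (hei y hy)), hJ'] at hJ
  have hJ2 := congrArg (fun v => (inner ℝ v (e i y) : ℝ)) hJ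
  simp only [inner_add_left, real_inner_smul_left, h.inner_eq hy, if_true] at hJ2
  linarith

end IsOrthonormalFrameOn
end FrameCalculus

/-! ### Connection and curvature matrices of an orthonormal frame -/

/-- The curvature matrices, contracted with two vectors. -/
theorem sum_sum_curvatureMatrix (G : Fin 7 → Matrix (Fin 7) (Fin 7) ℝ)
    (D : Fin 7 → Fin 7 → Matrix (Fin 7) (Fin 7) ℝ) (X Y : Fin 7 → ℝ) (l k : Fin 7)
    {A B : Matrix (Fin 7) (Fin 7) ℝ} (hA : ∀ i j, A i j = ∑ a, X a * G a i j)
    (hB : ∀ i j, B i j = ∑ b, Y b * G b i j) :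
    ∑ a, X a * ∑ b, Y b * curvatureMatrix G D a b l k =
      ∑ b, Y b * ∑ a, X a * D a b l k - ∑ a, X a * ∑ b, Y b * D b a l k
      - ∑ i, (∑ j, Y j * A i j - ∑ j, X j * B i j) * G i l k
      + (∑ m, A l m * B m k - ∑ m, B l m * A m k) := by
  have e1 : ∑ a, X a * ∑ b, Y b * D a b l k = ∑ b, Y b * ∑ a, X a * D a b l k := by
    simp only [Finset.mul_sum]
    rw [Finset.sum_comm]
    exact Finset.sum_congr rfl fun b _ => Finset.sum_congr rfl fun a _ => by ring
  have e2 : ∑ a, X a * ∑ b, Y b * ∑ i, G a i b * G i l k =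
      ∑ i, (∑ j, Y j * A i j) * G i l k := by
    simp only [hA, Finset.mul_sum, Finset.sum_mul]
    rw [Finset.sum_congr rfl fun a _ => Finset.sum_comm, Finset.sum_comm]
    refine Finset.sum_congr rfl fun i _ => ?_
    rw [Finset.sum_comm]
    exact Finset.sum_congr rfl fun b _ => Finset.sum_congr rfl fun a _ => by ring
  have e3 : ∑ a, X a * ∑ b, Y b * ∑ i, G b i a * G i l k =
      ∑ i, (∑ j, X j * B i j) * G i l k := by
    simp only [hB, Finset.mul_sum, Finset.sum_mul]
    rw [Finset.sum_congr rfl fun a _ => Finset.sum_comm, Finset.sum_comm]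
    exact Finset.sum_congr rfl fun i _ => Finset.sum_congr rfl fun b _ =>
      Finset.sum_congr rfl fun a _ => by ring
  have e4 : ∑ a, X a * ∑ b, Y b * ∑ m, G a l m * G b m k = ∑ m, A l m * B m k := by
    simp only [hA, hB, Finset.mul_sum, Finset.sum_mul]
    rw [Finset.sum_congr rfl fun a _ => Finset.sum_comm, Finset.sum_comm]
    refine Finset.sum_congr rfl fun i _ => ?_
    rw [Finset.sum_comm]
    exact Finset.sum_congr rfl fun b _ => Finset.sum_congr rfl fun a _ => by ring
  have e5 : ∑ a, X a * ∑ b, Y b * ∑ m, G b l m * G a m k = ∑ m, B l m * A m k := by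
    simp only [hA, hB, Finset.mul_sum, Finset.sum_mul]
    rw [Finset.sum_congr rfl fun a _ => Finset.sum_comm, Finset.sum_comm]
    exact Finset.sum_congr rfl fun i _ => Finset.sum_congr rfl fun b _ =>
      Finset.sum_congr rfl fun a _ => by ring
  simp only [curvatureMatrix, Matrix.add_apply, Matrix.sub_apply, Matrix.sum_apply,
    Matrix.smul_apply, Matrix.mul_apply, smul_eq_mul, sub_mul, mul_add, mul_sub,
    Finset.sum_add_distrib, Finset.sum_sub_distrib, e1, e2, e3, e4, e5]

section FrameCurvature

variable {E : Type*} [NormedAddCommGroup E] [NormedSpace ℝ E] [FiniteDimensional ℝ E]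
  {H : Type*} [TopologicalSpace H] {I : ModelWithCorners ℝ E H}
  {M : Type*} [TopologicalSpace M] [ChartedSpace H M] [IsManifold I ∞ M]
  [RiemannianBundle (fun x : M => TangentSpace I x)]
  [IsContMDiffRiemannianBundle I ∞ E (fun x : M => TangentSpace I x)]

theorem mdifferentiableAt_of_smooth {f : M → ℝ} {y : M} (hf : CMDiffAt ∞ f y) : MDiffAt f y :=
  hf.mdifferentiableAt (by simp)

theorem mdifferentiableAt_section_of_smooth {Z : Π x : M, TangentSpace I x} {y : M}
    (hZ : CMDiffAt ∞ (T% Z) y) : MDiffAt (T% Z) y :=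
  hZ.mdifferentiableAt (by simp)

theorem mvfderiv_sum_mul {f g : Fin 7 → M → ℝ} {y : M}
    (hf : ∀ i, MDiffAt (f i) y) (hg : ∀ i, MDiffAt (g i) y) (v : TangentSpace I y) :
    mvfderiv I (fun z => ∑ i, f i z * g i z) y v =
      ∑ i, (f i y * mvfderiv I (g i) y v + g i y * mvfderiv I (f i) y v) := by
  rw [mvfderiv_sum (f := fun i z => f i z * g i z) Finset.univ fun i _ => (hf i).mul (hg i)]
  simp only [_root_.sum_apply]
  refine Finset.sum_congr rfl fun i _ => ?_
  have := mvfderiv_fun_mul (hf i) (hg i)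
  change mvfderiv I (fun z => f i z * g i z) y v = _
  rw [this]
  simp

/-- The matrix `ω(v)_lk = g(∇_v e_k, e_l)` at `y` of the Levi-Civita connection in a frame `e`. -/
noncomputable def connectionMatrix (e : Fin 7 → Π x : M, TangentSpace I x) (y : M)
    (v : TangentSpace I y) : Matrix (Fin 7) (Fin 7) ℝ :=
  Matrix.of fun l k => inner ℝ (leviCivita I M (e k) y v) (e l y)

theorem connectionMatrix_apply (e : Fin 7 → Π x : M, TangentSpace I x) (y : M)
    (v : TangentSpace I y) (l k : Fin 7) :
    connectionMatrix e y v l k = inner ℝ (leviCivita I M (e k) y v) (e l y) := rfl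

/-- The matrix with entries the derivatives along `e_a` of the entries of `ω(e_b)`, at `y`. -/
noncomputable def connectionMatrixDeriv (e : Fin 7 → Π x : M, TangentSpace I x) (y : M)
    (a b : Fin 7) : Matrix (Fin 7) (Fin 7) ℝ :=
  Matrix.of fun l k => mvfderiv I (fun z => connectionMatrix e z (e b z) l k) y (e a y)

theorem connectionMatrixDeriv_apply (e : Fin 7 → Π x : M, TangentSpace I x) (y : M)
    (a b l k : Fin 7) : connectionMatrixDeriv e y a b l k =
      mvfderiv I (fun z => connectionMatrix e z (e b z) l k) y (e a y) := rfl

namespace IsOrthonormalFrameOn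

variable {e : Fin 7 → Π x : M, TangentSpace I x} {U : Set M}

/-- The connection matrix of an orthonormal frame is skew-symmetric, since `∇` is metric. -/
theorem connectionMatrix_transpose (h : IsOrthonormalFrameOn I e U) {y : M} (hy : y ∈ U)
    (v : TangentSpace I y) : (connectionMatrix e y v)ᵀ = -connectionMatrix e y v := by
  ext l k
  have hm := leviCivita_metric (I := I) (mdifferentiableAt_extend I E v)
    (h.mdifferentiableAt hy k) (h.mdifferentiableAt hy l)
  have hc : (fun z => (inner ℝ (e k z) (e l z) : ℝ)) =ᶠ[𝓝 y] fun _ => if k = l then 1 else 0 := by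
    filter_upwards [h.mem_nhds hy] with z hz
    exact h.inner_eq hz k l
  rw [mvfderiv_eq_zero_of_eventuallyEq_const hc, extend_apply_self, real_inner_comm _ (e k y)] at hm
  simp only [Matrix.transpose_apply, Matrix.neg_apply, connectionMatrix_apply]
  simp only [_root_.zero_apply] at hm
  linarith

theorem connectionMatrix_eq_sum (h : IsOrthonormalFrameOn I e U) {y : M} (hy : y ∈ U)
    (v : TangentSpace I y) (l k : Fin 7) : connectionMatrix e y v l k =
      ∑ a, (inner ℝ v (e a y) : ℝ) * connectionMatrix e y (e a y) l k := by
  simp only [connectionMatrix_apply]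
  conv_lhs => rw [← h.sum_inner_smul hy v]
  simp only [map_sum, map_smul, sum_inner, real_inner_smul_left]

theorem mvfderiv_eq_sum (h : IsOrthonormalFrameOn I e U) {y : M} (hy : y ∈ U)
    (v : TangentSpace I y) (f : M → ℝ) : mvfderiv I f y v =
      ∑ a, (inner ℝ v (e a y) : ℝ) * mvfderiv I f y (e a y) := by
  conv_lhs => rw [← h.sum_inner_smul hy v]
  simp only [map_sum, map_smul, smul_eq_mul]

/-- Components of a covariant derivative in an orthonormal frame. -/
theorem inner_leviCivita_frame (h : IsOrthonormalFrameOn I e U) {y : M} (hy : y ∈ U)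
    {Z : Π x : M, TangentSpace I x} (hZ : MDiffAt (T% Z) y) (v : TangentSpace I y) (l : Fin 7) :
    (inner ℝ (leviCivita I M Z y v) (e l y) : ℝ) =
      mvfderiv I (fun z => (inner ℝ (Z z) (e l z) : ℝ)) y v
        + ∑ k, (inner ℝ (Z y) (e k y) : ℝ) * connectionMatrix e y v l k := by
  have hm := leviCivita_metric (I := I) (mdifferentiableAt_extend I E v) hZ
    (h.mdifferentiableAt hy l)
  rw [extend_apply_self] at hm
  have h1 : (inner ℝ (Z y) (leviCivita I M (e l) y v) : ℝ) =
      -∑ k, (inner ℝ (Z y) (e k y) : ℝ) * connectionMatrix e y v l k := by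
    rw [h.inner_eq_sum hy, ← Finset.sum_neg_distrib]
    refine Finset.sum_congr rfl fun k _ => ?_
    have := congrFun (congrFun (h.connectionMatrix_transpose hy v) l) k
    simp only [Matrix.transpose_apply, Matrix.neg_apply] at this
    rw [← connectionMatrix_apply, this]
    ring
  linarith

theorem inner_mlieBracket_frame (h : IsOrthonormalFrameOn I e U) {y : M} (hy : y ∈ U)
    {V W : Π x : M, TangentSpace I x} (hV : MDiffAt (T% V) y) (hW : MDiffAt (T% W) y) (l : Fin 7) :
    (inner ℝ (mlieBracket I V W y) (e l y) : ℝ) =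
      mvfderiv I (fun z => (inner ℝ (W z) (e l z) : ℝ)) y (V y)
        - mvfderiv I (fun z => (inner ℝ (V z) (e l z) : ℝ)) y (W y)
        + (∑ k, (inner ℝ (W y) (e k y) : ℝ) * connectionMatrix e y (V y) l k
          - ∑ k, (inner ℝ (V y) (e k y) : ℝ) * connectionMatrix e y (W y) l k) := by
  rw [leviCivita_bracket hV hW, inner_sub_left, h.inner_leviCivita_frame hy hV,
    h.inner_leviCivita_frame hy hW]
  ring

/-- The connection matrix is smooth: the Koszul formula expresses it through the brackets of the
frame fields. -/
theorem contMDiffAt_connectionMatrix_frame (h : IsOrthonormalFrameOn I e U) {y : M} (hy : y ∈ U)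
    (a l k : Fin 7) : CMDiffAt ∞ (fun z => connectionMatrix e z (e a z) l k) y := by
  have hb : ∀ i j m, CMDiffAt ∞ (fun z => (inner ℝ (mlieBracket I (e i) (e j) z) (e m z) : ℝ)) y :=
    fun i j m => contMDiffAt_inner (contMDiffAt_mlieBracket (h.smooth i y hy) (h.smooth j y hy))
      (h.smooth m y hy)
  have h1 : CMDiffAt ∞ (fun z => (1 / 2 : ℝ) * ((inner ℝ (mlieBracket I (e a) (e k) z) (e l z) : ℝ)
      - inner ℝ (mlieBracket I (e a) (e l) z) (e k z)
      - inner ℝ (mlieBracket I (e k) (e l) z) (e a z))) y :=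
    contMDiffAt_const.mul (((hb a k l).sub (hb a l k)).sub (hb k l a))
  refine h1.congr_of_eventuallyEq ?_
  filter_upwards [h.mem_nhds hy] with z hz
  have hc : ∀ i j, mvfderiv I (fun w => (inner ℝ (e i w) (e j w) : ℝ)) z = 0 := fun i j => by
    refine mvfderiv_eq_zero_of_eventuallyEq_const (c := if i = j then 1 else 0) ?_
    filter_upwards [h.mem_nhds hz] with w hw
    exact h.inner_eq hw i j
  rw [connectionMatrix_apply, inner_leviCivita (h.mdifferentiableAt hz a)
    (h.mdifferentiableAt hz k) (h.mdifferentiableAt hz l), koszul]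
  simp only [hc, _root_.zero_apply]
  ring

theorem contMDiffAt_connectionMatrix (h : IsOrthonormalFrameOn I e U)
    {V : Π x : M, TangentSpace I x} {y : M} (hV : CMDiffAt ∞ (T% V) y) (hy : y ∈ U)
    (l k : Fin 7) : CMDiffAt ∞ (fun z => connectionMatrix e z (V z) l k) y := by
  have h1 : CMDiffAt ∞ (fun z => ∑ a, (inner ℝ (V z) (e a z) : ℝ) *
      connectionMatrix e z (e a z) l k) y :=
    contMDiffAt_finsetSum fun a _ => (contMDiffAt_inner hV (h.smooth a y hy)).mul
      (h.contMDiffAt_connectionMatrix_frame hy a l k)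
  refine h1.congr_of_eventuallyEq ?_
  filter_upwards [h.mem_nhds hy] with z hz
  exact h.connectionMatrix_eq_sum hz (V z) l k

theorem contMDiffAt_leviCivita (h : IsOrthonormalFrameOn I e U)
    {V Z : Π x : M, TangentSpace I x}
    (hV : ∀ y ∈ U, CMDiffAt ∞ (T% V) y) (hZ : ∀ y ∈ U, CMDiffAt ∞ (T% Z) y) {y : M} (hy : y ∈ U) :
    CMDiffAt ∞ (T% (fun z => leviCivita I M Z z (V z))) y := by
  refine h.smooth_of_inner (fun l y hy => ?_) hy
  have hZl : ∀ l, ∀ y ∈ U, CMDiffAt ∞ (fun z => (inner ℝ (Z z) (e l z) : ℝ)) y := fun l y hy =>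
    contMDiffAt_inner (hZ y hy) (h.smooth l y hy)
  have h1 : CMDiffAt ∞ (fun z => mvfderiv I (fun w => (inner ℝ (Z w) (e l w) : ℝ)) z (V z)
      + ∑ k, (inner ℝ (Z z) (e k z) : ℝ) * connectionMatrix e z (V z) l k) y :=
    (h.contMDiffAt_mvfderiv (hZl l) hV hy).add (contMDiffAt_finsetSum fun k _ =>
      (hZl k y hy).mul (h.contMDiffAt_connectionMatrix (hV y hy) hy l k))
  refine h1.congr_of_eventuallyEq ?_
  filter_upwards [h.mem_nhds hy] with z hz
  exact h.inner_leviCivita_frame hz (mdifferentiableAt_section_of_smooth (hZ z hz)) (V z) l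

/-- Components of a second covariant derivative in an orthonormal frame. -/
theorem inner_leviCivita_leviCivita (h : IsOrthonormalFrameOn I e U)
    {X Y Z : Π x : M, TangentSpace I x} (hY : ∀ y ∈ U, CMDiffAt ∞ (T% Y) y)
    (hZ : ∀ y ∈ U, CMDiffAt ∞ (T% Z) y) {x : M} (hx : x ∈ U) (l : Fin 7) :
    (inner ℝ (leviCivita I M (fun y => leviCivita I M Z y (Y y)) x (X x)) (e l x) : ℝ) =
      mvfderiv I (fun y => mvfderiv I (fun z => (inner ℝ (Z z) (e l z) : ℝ)) y (Y y)) x (X x)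
      + ∑ k, ((inner ℝ (Z x) (e k x) : ℝ) *
            mvfderiv I (fun z => connectionMatrix e z (Y z) l k) x (X x)
          + connectionMatrix e x (Y x) l k *
            mvfderiv I (fun z => (inner ℝ (Z z) (e k z) : ℝ)) x (X x))
      + ∑ m, (mvfderiv I (fun z => (inner ℝ (Z z) (e m z) : ℝ)) x (Y x)
          + ∑ k, (inner ℝ (Z x) (e k x) : ℝ) * connectionMatrix e x (Y x) m k) *
        connectionMatrix e x (X x) l m := by
  have hZl : ∀ l, ∀ y ∈ U, CMDiffAt ∞ (fun z => (inner ℝ (Z z) (e l z) : ℝ)) y := fun l y hy =>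
    contMDiffAt_inner (hZ y hy) (h.smooth l y hy)
  have hc : ∀ l, ∀ y ∈ U, (inner ℝ (leviCivita I M Z y (Y y)) (e l y) : ℝ) =
      mvfderiv I (fun z => (inner ℝ (Z z) (e l z) : ℝ)) y (Y y)
        + ∑ k, (inner ℝ (Z y) (e k y) : ℝ) * connectionMatrix e y (Y y) l k := fun l y hy =>
    h.inner_leviCivita_frame hy (mdifferentiableAt_section_of_smooth (hZ y hy)) (Y y) l
  rw [h.inner_leviCivita_frame hx (mdifferentiableAt_section_of_smooth
    (h.contMDiffAt_leviCivita hY hZ hx))]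
  have h1 : (fun y => (inner ℝ (leviCivita I M Z y (Y y)) (e l y) : ℝ)) =ᶠ[𝓝 x]
      fun y => mvfderiv I (fun z => (inner ℝ (Z z) (e l z) : ℝ)) y (Y y)
        + ∑ k, (inner ℝ (Z y) (e k y) : ℝ) * connectionMatrix e y (Y y) l k := by
    filter_upwards [h.mem_nhds hx] with y hy
    exact hc l y hy
  have h2 := mdifferentiableAt_of_smooth (h.contMDiffAt_mvfderiv (hZl l) hY hx)
  have h3 : ∀ k, MDiffAt (fun z => connectionMatrix e z (Y z) l k) x := fun k =>
    mdifferentiableAt_of_smooth (h.contMDiffAt_connectionMatrix (hY x hx) hx l k)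
  have h4 : ∀ k, MDiffAt (fun z => (inner ℝ (Z z) (e k z) : ℝ)) x := fun k =>
    mdifferentiableAt_of_smooth (hZl k x hx)
  have h5 : MDiffAt
      (fun y => ∑ k, (inner ℝ (Z y) (e k y) : ℝ) * connectionMatrix e y (Y y) l k) x :=
    mdifferentiableAt_of_smooth (contMDiffAt_finsetSum fun k _ =>
      (hZl k x hx).mul (h.contMDiffAt_connectionMatrix (hY x hx) hx l k))
  rw [mvfderiv_congr_of_eventuallyEq h1, mvfderiv_fun_add h2 h5, _root_.add_apply,
    mvfderiv_sum_mul h4 h3]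
  simp only [hc _ x hx]

/-- The curvature of the Levi-Civita connection in an orthonormal frame, by the structure equation
`Ω = dω + ω ∧ ω`. -/
theorem inner_curvature_fields (h : IsOrthonormalFrameOn I e U)
    {X Y Z : Π x : M, TangentSpace I x} (hX : ∀ y ∈ U, CMDiffAt ∞ (T% X) y)
    (hY : ∀ y ∈ U, CMDiffAt ∞ (T% Y) y)
    (hZ : ∀ y ∈ U, CMDiffAt ∞ (T% Z) y) {x : M} (hx : x ∈ U) (l : Fin 7) :
    (inner ℝ (leviCivita I M (fun y => leviCivita I M Z y (Y y)) x (X x)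
        - leviCivita I M (fun y => leviCivita I M Z y (X y)) x (Y x)
        - leviCivita I M Z x (mlieBracket I X Y x)) (e l x) : ℝ) =
      ∑ k, (inner ℝ (Z x) (e k x) : ℝ) * ∑ a, (inner ℝ (X x) (e a x) : ℝ) *
        ∑ b, (inner ℝ (Y x) (e b x) : ℝ) *
        curvatureMatrix (fun a => connectionMatrix e x (e a x)) (connectionMatrixDeriv e x)
          a b l k := by
  have hcomp : ∀ {V : Π x : M, TangentSpace I x}, (∀ y ∈ U, CMDiffAt ∞ (T% V) y) →
      ∀ l, ∀ y ∈ U, CMDiffAt ∞ (fun z => (inner ℝ (V z) (e l z) : ℝ)) y := fun hV l y hy =>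
    contMDiffAt_inner (hV y hy) (h.smooth l y hy)
  have hω : ∀ {V W : Π x : M, TangentSpace I x}, (∀ y ∈ U, CMDiffAt ∞ (T% W) y) → ∀ l k,
      mvfderiv I (fun z => connectionMatrix e z (W z) l k) x (V x) =
        ∑ b, ((inner ℝ (W x) (e b x) : ℝ) *
            ∑ a, (inner ℝ (V x) (e a x) : ℝ) * connectionMatrixDeriv e x a b l k
          + connectionMatrix e x (e b x) l k *
            mvfderiv I (fun z => (inner ℝ (W z) (e b z) : ℝ)) x (V x)) := by
    intro V W hW l k
    have h1 : (fun z => connectionMatrix e z (W z) l k) =ᶠ[𝓝 x] fun z =>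
        ∑ b, (inner ℝ (W z) (e b z) : ℝ) * connectionMatrix e z (e b z) l k := by
      filter_upwards [h.mem_nhds hx] with z hz
      exact h.connectionMatrix_eq_sum hz (W z) l k
    rw [mvfderiv_congr_of_eventuallyEq h1, mvfderiv_sum_mul
      (fun b => mdifferentiableAt_of_smooth (hcomp hW b x hx))
      (fun b => mdifferentiableAt_of_smooth (h.contMDiffAt_connectionMatrix_frame hx b l k))]
    refine Finset.sum_congr rfl fun b _ => ?_
    rw [h.mvfderiv_eq_sum hx (V x) fun z => connectionMatrix e z (e b z) l k]
    rfl
  rw [inner_sub_left, inner_sub_left, h.inner_leviCivita_leviCivita hY hZ hx,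
    h.inner_leviCivita_leviCivita hX hZ hx,
    h.inner_leviCivita_frame hx (mdifferentiableAt_section_of_smooth (hZ x hx)),
    h.mvfderiv_mlieBracket (hcomp hZ l) hX hY hx]
  simp only [hω hX, hω hY]
  rw [Finset.sum_congr rfl fun k _ => congrArg _
    (h.connectionMatrix_eq_sum hx (mlieBracket I X Y x) l k)]
  simp only [h.inner_mlieBracket_frame hx (mdifferentiableAt_section_of_smooth (hX x hx))
    (mdifferentiableAt_section_of_smooth (hY x hx))]
  simp only [sum_sum_curvatureMatrix _ _ _ _ l _ (h.connectionMatrix_eq_sum hx (X x))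
    (h.connectionMatrix_eq_sum hx (Y x))]
  have e1 : ∀ A B : Matrix (Fin 7) (Fin 7) ℝ,
      ∑ m, (∑ k, (inner ℝ (Z x) (e k x) : ℝ) * B m k) * A l m =
        ∑ k, (inner ℝ (Z x) (e k x) : ℝ) * ∑ m, A l m * B m k := fun A B => by
    simp only [Finset.mul_sum, Finset.sum_mul]
    rw [Finset.sum_comm]
    exact Finset.sum_congr rfl fun k _ => Finset.sum_congr rfl fun m _ => by ring
  simp only [add_mul, sub_mul, mul_add, mul_sub, Finset.sum_add_distrib, Finset.sum_sub_distrib, e1]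
  simp only [mul_comm (mvfderiv I _ _ _)]
  ring

end IsOrthonormalFrameOn
end FrameCurvature

/-! ### The first Bianchi identity and the scalar curvature in a frame -/

section FrameScalarCurvature

variable {E : Type*} [NormedAddCommGroup E] [NormedSpace ℝ E] [FiniteDimensional ℝ E]
  {H : Type*} [TopologicalSpace H] {I : ModelWithCorners ℝ E H}
  {M : Type*} [TopologicalSpace M] [ChartedSpace H M] [IsManifold I ∞ M]
  [RiemannianBundle (fun x : M => TangentSpace I x)]
  [IsContMDiffRiemannianBundle I ∞ E (fun x : M => TangentSpace I x)]

namespace IsOrthonormalFrameOn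

variable {e : Fin 7 → Π x : M, TangentSpace I x} {U : Set M}

theorem connectionMatrixDeriv_transpose (h : IsOrthonormalFrameOn I e U) {x : M} (hx : x ∈ U)
    (a b : Fin 7) : (connectionMatrixDeriv e x a b)ᵀ = -connectionMatrixDeriv e x a b := by
  ext l k
  have h1 : (fun z => connectionMatrix e z (e b z) k l) =ᶠ[𝓝 x]
      fun z => -connectionMatrix e z (e b z) l k := by
    filter_upwards [h.mem_nhds hx] with z hz
    exact congrFun (congrFun (h.connectionMatrix_transpose hz (e b z)) l) k
  rw [Matrix.transpose_apply, Matrix.neg_apply, connectionMatrixDeriv_apply,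
    connectionMatrixDeriv_apply, mvfderiv_congr_of_eventuallyEq h1, mvfderiv_fun_neg]
  rfl

theorem inner_mlieBracket_frame_frame (h : IsOrthonormalFrameOn I e U) {y : M} (hy : y ∈ U)
    (b k l : Fin 7) : (inner ℝ (mlieBracket I (e b) (e k) y) (e l y) : ℝ) =
      connectionMatrix e y (e b y) l k - connectionMatrix e y (e k y) l b := by
  rw [leviCivita_bracket (h.mdifferentiableAt hy b) (h.mdifferentiableAt hy k), inner_sub_left]
  rfl

theorem inner_mlieBracket_mlieBracket_frame (h : IsOrthonormalFrameOn I e U) {x : M} (hx : x ∈ U)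
    (a b k l : Fin 7) :
    (inner ℝ (mlieBracket I (e a) (mlieBracket I (e b) (e k)) x) (e l x) : ℝ) =
      connectionMatrixDeriv e x a b l k - connectionMatrixDeriv e x a k l b
      + ∑ i, (connectionMatrix e x (e b x) i k - connectionMatrix e x (e k x) i b) *
        (connectionMatrix e x (e a x) l i - connectionMatrix e x (e i x) l a) := by
  have hW := contMDiffAt_mlieBracket (h.smooth b x hx) (h.smooth k x hx)
  rw [h.inner_mlieBracket_frame hx (h.mdifferentiableAt hx a)
    (mdifferentiableAt_section_of_smooth hW)]
  have h1 : (fun z => (inner ℝ (mlieBracket I (e b) (e k) z) (e l z) : ℝ)) =ᶠ[𝓝 x] fun z =>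
      connectionMatrix e z (e b z) l k - connectionMatrix e z (e k z) l b := by
    filter_upwards [h.mem_nhds hx] with z hz
    exact h.inner_mlieBracket_frame_frame hz b k l
  have h2 : (fun z => (inner ℝ (e a z) (e l z) : ℝ)) =ᶠ[𝓝 x] fun _ => if a = l then 1 else 0 := by
    filter_upwards [h.mem_nhds hx] with z hz
    exact h.inner_eq hz a l
  rw [mvfderiv_congr_of_eventuallyEq h1, mvfderiv_eq_zero_of_eventuallyEq_const h2,
    mvfderiv_fun_sub
      (mdifferentiableAt_of_smooth (h.contMDiffAt_connectionMatrix_frame hx b l k))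
      (mdifferentiableAt_of_smooth (h.contMDiffAt_connectionMatrix_frame hx k l b))]
  have h3 : ∀ f : Fin 7 → ℝ, ∑ i, (inner ℝ (e a x) (e i x) : ℝ) * f i = f a := fun f => by
    simp [h.inner_eq hx]
  rw [h3 fun i => connectionMatrix e x (mlieBracket I (e b) (e k) x) l i,
    h.connectionMatrix_eq_sum hx (mlieBracket I _ _ x), ← Finset.sum_sub_distrib]
  simp only [h.inner_mlieBracket_frame_frame hx, _root_.sub_apply, _root_.zero_apply, ← mul_sub,
    sub_zero, connectionMatrixDeriv_apply]

/-- The first Bianchi identity, from the Jacobi identity for the frame fields. -/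
theorem bianchi (h : IsOrthonormalFrameOn I e U) {x : M} (hx : x ∈ U) (a b k l : Fin 7) :
    curvatureMatrix (fun a => connectionMatrix e x (e a x)) (connectionMatrixDeriv e x) a b l k
      + curvatureMatrix (fun a => connectionMatrix e x (e a x)) (connectionMatrixDeriv e x) b k l a
      + curvatureMatrix (fun a => connectionMatrix e x (e a x)) (connectionMatrixDeriv e x) k a l b
      = 0 := by
  have : IsManifold I (minSmoothness ℝ 3) M := by
    rw [minSmoothness_of_isRCLikeNormedField]; infer_instance
  have hle : minSmoothness ℝ 2 ≤ (∞ : ℕ∞ω) := by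
    rw [minSmoothness_of_isRCLikeNormedField]; exact ENat.LEInfty.out
  have hJ := leibniz_identity_mlieBracket_apply (I := I) (x := x) ((h.smooth a x hx).of_le hle)
    ((h.smooth b x hx).of_le hle) ((h.smooth k x hx).of_le hle)
  rw [mlieBracket_swap_apply (V := mlieBracket I (e a) (e b))] at hJ
  have hJ2 := congrArg (fun v => (inner ℝ v (e l x) : ℝ)) hJ
  simp only [inner_add_left, inner_neg_left, h.inner_mlieBracket_mlieBracket_frame hx] at hJ2
  simp only [curvatureMatrix, Matrix.add_apply, Matrix.sub_apply, Matrix.sum_apply,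
    Matrix.smul_apply, Matrix.mul_apply, smul_eq_mul, sub_mul, mul_sub,
    Finset.sum_sub_distrib] at hJ2 ⊢
  simp only [mul_comm (connectionMatrix e x (e _ x) l _)]
  linarith

/-- The curvature tensor in an orthonormal frame. Its definition uses extensions of tangent vectors
that are smooth only near `x`, so the frame is restricted to a smaller neighbourhood. -/
theorem inner_curvature (h : IsOrthonormalFrameOn I e U) {x : M} (hx : x ∈ U)
    (u v w : TangentSpace I x) (l : Fin 7) :
    (inner ℝ (curvature x u v w) (e l x) : ℝ) =
      ∑ k, (inner ℝ w (e k x) : ℝ) * ∑ a, (inner ℝ u (e a x) : ℝ) *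
        ∑ b, (inner ℝ v (e b x) : ℝ) *
        curvatureMatrix (fun a => connectionMatrix e x (e a x)) (connectionMatrixDeriv e x)
          a b l k := by
  let t : Set M := (trivializationAt E (fun x : M => TangentSpace I x) x).baseSet
  have ht : IsOpen t := (trivializationAt E (fun x : M => TangentSpace I x) x).open_baseSet
  have hxt : x ∈ t := FiberBundle.mem_baseSet_trivializationAt' x
  have hs : ∀ u : TangentSpace I x, ∃ s ∈ 𝓝 x, CMDiff[s] ∞ (T% (extend E u)) := fun u =>
    exists_contMDiffOn_extend I E u
  obtain ⟨s₁, h₁, hu⟩ := hs u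
  obtain ⟨s₂, h₂, hv⟩ := hs v
  obtain ⟨s₃, h₃, hw⟩ := hs w
  obtain ⟨U', hU', hopen, hxU'⟩ := mem_nhds_iff.1
    (Filter.inter_mem (h.mem_nhds hx) (Filter.inter_mem h₁ (Filter.inter_mem h₂ h₃)))
  have h' := h.mono hopen fun y hy => (hU' hy).1
  have key := h'.inner_curvature_fields (X := extend E u) (Y := extend E v) (Z := extend E w)
    (fun y hy => hu.contMDiffAt
      (Filter.mem_of_superset (hopen.mem_nhds hy) fun z hz => (hU' hz).2.1))
    (fun y hy => hv.contMDiffAt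
      (Filter.mem_of_superset (hopen.mem_nhds hy) fun z hz => (hU' hz).2.2.1))
    (fun y hy => hw.contMDiffAt
      (Filter.mem_of_superset (hopen.mem_nhds hy) fun z hz => (hU' hz).2.2.2))
    hxU' l
  simp only [extend_apply_self] at key
  exact key

theorem sum_inner_mul_inner {κ : Type*} [Fintype κ] (h : IsOrthonormalFrameOn I e U) {x : M}
    (hx : x ∈ U) (b : OrthonormalBasis κ ℝ (TangentSpace I x)) (l a : Fin 7) :
    ∑ i, (inner ℝ (b i) (e l x) : ℝ) * inner ℝ (b i) (e a x) = if l = a then 1 else 0 := by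
  rw [← h.inner_eq hx l a, ← b.sum_inner_mul_inner]
  exact Finset.sum_congr rfl fun i _ => by rw [real_inner_comm (e l x)]

/-- The scalar curvature in an orthonormal frame. -/
theorem scalarCurvature_eq (h : IsOrthonormalFrameOn I e U) {x : M} (hx : x ∈ U) :
    scalarCurvature I x = ∑ a, ∑ b,
      curvatureMatrix (fun a => connectionMatrix e x (e a x)) (connectionMatrixDeriv e x)
        a b a b := by
  set K := curvatureMatrix (fun a => connectionMatrix e x (e a x)) (connectionMatrixDeriv e x)
  let b := stdOrthonormalBasis ℝ (TangentSpace I x)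
  have hs : scalarCurvature I x =
      ∑ i, ∑ j, (inner ℝ (curvature x (b i) (b j) (b j)) (b i) : ℝ) := rfl
  have h1 : ∀ i j, (inner ℝ (curvature x (b i) (b j) (b j)) (b i) : ℝ) =
      ∑ l, ∑ a, ∑ k, ∑ c, ((inner ℝ (b i) (e l x) : ℝ) * inner ℝ (b i) (e a x)) *
        (((inner ℝ (b j) (e k x) : ℝ) * inner ℝ (b j) (e c x)) * K a c l k) := fun i j => by
    rw [h.inner_eq_sum hx]
    simp only [h.inner_curvature hx]
    refine Finset.sum_congr rfl fun l _ => ?_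
    simp only [Finset.mul_sum, Finset.sum_mul]
    rw [Finset.sum_comm]
    refine Finset.sum_congr rfl fun a _ => Finset.sum_congr rfl fun k _ =>
      Finset.sum_congr rfl fun c _ => ?_
    ring
  have h2 : ∀ i, ∑ j, (inner ℝ (curvature x (b i) (b j) (b j)) (b i) : ℝ) =
      ∑ l, ∑ a, ((inner ℝ (b i) (e l x) : ℝ) * inner ℝ (b i) (e a x)) * ∑ k, K a k l k := by
    intro i
    simp only [h1]
    rw [Finset.sum_comm]; refine Finset.sum_congr rfl fun l _ => ?_
    rw [Finset.sum_comm]; refine Finset.sum_congr rfl fun a _ => ?_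
    rw [Finset.sum_comm, Finset.mul_sum]; refine Finset.sum_congr rfl fun k _ => ?_
    rw [Finset.sum_comm]
    simp only [← Finset.mul_sum, ← Finset.sum_mul, h.sum_inner_mul_inner hx b]
    simp
  rw [hs]
  simp only [h2]
  rw [Finset.sum_comm]; refine Finset.sum_congr rfl fun l _ => ?_
  rw [Finset.sum_comm]
  simp only [← Finset.sum_mul, h.sum_inner_mul_inner hx b]
  simp

end IsOrthonormalFrameOn
end FrameScalarCurvature

/-! ### Adapted frames -/

/-- The trace of a bilinear map over an orthonormal basis does not depend on the basis. -/
theorem sum_bilinear_orthonormalBasis {V W κ κ' : Type*} [NormedAddCommGroup V]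
    [InnerProductSpace ℝ V] [AddCommGroup W] [Module ℝ W] [Fintype κ] [Fintype κ']
    (b : OrthonormalBasis κ ℝ V) (b' : OrthonormalBasis κ' ℝ V) (B : V →ₗ[ℝ] V →ₗ[ℝ] W) :
    ∑ i, B (b i) (b i) = ∑ j, B (b' j) (b' j) := by
  have h1 : ∀ i, B (b i) (b i) = ∑ j, B (b' j) ((inner ℝ (b' j) (b i) : ℝ) • b i) := fun i => by
    conv_lhs => rw [show B (b i) = B (∑ j, (inner ℝ (b' j) (b i) : ℝ) • b' j) by
      rw [b'.sum_repr' (b i)]]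
    simp [map_sum, LinearMap.sum_apply]
  simp only [h1]
  rw [Finset.sum_comm]
  refine Finset.sum_congr rfl fun j _ => ?_
  rw [← map_sum]
  congr 1
  conv_rhs => rw [← b.sum_repr' (b' j)]
  exact Finset.sum_congr rfl fun i _ => by rw [real_inner_comm]

/-- Expansion of a trilinear form; the nested shape of the sums allows differentiating one factor at
a time. -/
theorem trilinear_sum_smul {V κ : Type*} [AddCommGroup V] [Module ℝ V] [Fintype κ]
    (φ : V →ₗ[ℝ] V →ₗ[ℝ] V →ₗ[ℝ] ℝ) (f : κ → V) (a b c : κ → ℝ) :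
    φ (∑ i, a i • f i) (∑ j, b j • f j) (∑ k, c k • f k) =
      ∑ i, a i * ∑ j, b j * ∑ k, c k * φ (f i) (f j) (f k) := by
  rw [map_sum φ, LinearMap.sum_apply, LinearMap.sum_apply]
  refine Finset.sum_congr rfl fun i _ => ?_
  rw [map_smul, LinearMap.smul_apply, LinearMap.smul_apply, smul_eq_mul, map_sum (φ (f i)),
    LinearMap.sum_apply]
  congr 1
  refine Finset.sum_congr rfl fun j _ => ?_
  rw [map_smul, LinearMap.smul_apply, smul_eq_mul, map_sum]
  simp only [map_smul, smul_eq_mul]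

section AdaptedFrames

variable {M : Type*} [TopologicalSpace M] [ChartedSpace (EuclideanSpace ℝ (Fin 7)) M]
  [IsManifold (𝓡 7) ∞ M] [RiemannianBundle (fun x : M => TangentSpace (𝓡 7) x)]

theorem IsAdaptedFrameOn.isOrthonormalFrameOn {φ : TrilinearField M}
    {e : Fin 7 → Π x : M, TangentSpace (𝓡 7) x} {U : Set M} (h : IsAdaptedFrameOn φ e U)
    (hU : IsOpen U) : IsOrthonormalFrameOn (𝓡 7) e U where
  isOpen := hU
  smooth i y hy := (h.smooth i).contMDiffAt (hU.mem_nhds hy)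
  orthonormal := h.orthonormal
  card_eq := by rw [finrank_euclideanSpace_fin]; simp

variable [IsContMDiffRiemannianBundle (𝓡 7) ∞ (EuclideanSpace ℝ (Fin 7))
  (fun x : M => TangentSpace (𝓡 7) x)]

namespace G2Structure

variable {G : G2Structure M} {e : Fin 7 → Π x : M, TangentSpace (𝓡 7) x} {U : Set M}

theorem form_frame_right (h : IsAdaptedFrameOn G.form e U) (hU : IsOpen U) {y : M} (hy : y ∈ U)
    (i j : Fin 7) (w : TangentSpace (𝓡 7) y) : G.form y (e i y) (e j y) w =
      ∑ k, (inner ℝ w (e k y) : ℝ) * eps i j k := by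
  conv_lhs => rw [← (h.isOrthonormalFrameOn hU).sum_inner_smul hy w]
  simp only [map_sum, map_smul, smul_eq_mul, h.form_eq y hy]

theorem form_frame_middle (h : IsAdaptedFrameOn G.form e U) (hU : IsOpen U) {y : M} (hy : y ∈ U)
    (i k : Fin 7) (v : TangentSpace (𝓡 7) y) : G.form y (e i y) v (e k y) =
      ∑ j, (inner ℝ v (e j y) : ℝ) * eps i j k := by
  conv_lhs => rw [← (h.isOrthonormalFrameOn hU).sum_inner_smul hy v]
  simp only [map_sum, map_smul, LinearMap.sum_apply, LinearMap.smul_apply, smul_eq_mul,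
    h.form_eq y hy]

theorem form_frame_left (h : IsAdaptedFrameOn G.form e U) (hU : IsOpen U) {y : M} (hy : y ∈ U)
    (j k : Fin 7) (u : TangentSpace (𝓡 7) y) : G.form y u (e j y) (e k y) =
      ∑ i, (inner ℝ u (e i y) : ℝ) * eps i j k := by
  conv_lhs => rw [← (h.isOrthonormalFrameOn hU).sum_inner_smul hy u]
  simp only [map_sum, map_smul, LinearMap.sum_apply, LinearMap.smul_apply, smul_eq_mul,
    h.form_eq y hy]

theorem form_eq_sum (h : IsAdaptedFrameOn G.form e U) (hU : IsOpen U) {y : M} (hy : y ∈ U)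
    (u v w : TangentSpace (𝓡 7) y) : G.form y u v w =
      ∑ i, (inner ℝ u (e i y) : ℝ) * ∑ j, (inner ℝ v (e j y) : ℝ) *
        ∑ k, (inner ℝ w (e k y) : ℝ) * eps i j k := by
  conv_lhs => rw [← (h.isOrthonormalFrameOn hU).sum_inner_smul hy u,
    ← (h.isOrthonormalFrameOn hU).sum_inner_smul hy v,
    ← (h.isOrthonormalFrameOn hU).sum_inner_smul hy w]
  rw [trilinear_sum_smul]
  simp only [h.form_eq y hy]

/-- The vector `∑_l e_l × ∇_v e_l` of an adapted frame, in components. -/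
theorem inner_sum_cross (h : IsAdaptedFrameOn G.form e U) (hU : IsOpen U) {y : M} (hy : y ∈ U)
    (v : TangentSpace (𝓡 7) y) (m : Fin 7) :
    (inner ℝ (∑ l, G.cross y (e l y) (leviCivita (𝓡 7) M (e l) y v)) (e m y) : ℝ) =
      (crossMatrix m * connectionMatrix e y v).trace := by
  rw [sum_inner, trace_crossMatrix_mul, Finset.sum_comm, ← Finset.sum_neg_distrib]
  refine Finset.sum_congr rfl fun l _ => ?_
  rw [inner_cross, form_frame_middle h hU hy, ← Finset.sum_neg_distrib]
  refine Finset.sum_congr rfl fun k _ => ?_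
  rw [connectionMatrix_apply, eps_swap k l]; push_cast; ring

/-- Over overlapping adapted frames the vector `∑_l e_l × ∇_v e_l` is the same: the logarithmic
derivative of the change of frame takes values in the Lie algebra of `G_2`. -/
theorem sum_cross_frame_eq {f : Fin 7 → Π x : M, TangentSpace (𝓡 7) x} {U' : Set M}
    (h : IsAdaptedFrameOn G.form e U) (hU : IsOpen U) (h' : IsAdaptedFrameOn G.form f U')
    (hU' : IsOpen U') {y : M} (hy : y ∈ U) (hy' : y ∈ U') (v : TangentSpace (𝓡 7) y) :
    ∑ l, G.cross y (f l y) (leviCivita (𝓡 7) M (f l) y v) =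
      ∑ l, G.cross y (e l y) (leviCivita (𝓡 7) M (e l) y v) := by
  have he := h.isOrthonormalFrameOn hU
  have hf := h'.isOrthonormalFrameOn hU'
  -- `H` is the change of frame and `B` its logarithmic derivative along `v`.
  let H : Fin 7 → Fin 7 → M → ℝ := fun p l z => inner ℝ (f l z) (e p z)
  let dH : Fin 7 → Fin 7 → ℝ := fun p l => mvfderiv (𝓡 7) (H p l) y v
  have hH : ∀ p l, MDifferentiableAt (𝓡 7) 𝓘(ℝ, ℝ) (H p l) y := fun p l =>
    mdifferentiableAt_of_smooth (contMDiffAt_inner (hf.smooth l y hy') (he.smooth p y hy))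
  let B : Fin 7 → Fin 7 → ℝ := fun p s => ∑ i, dH p i * H s i y
  let D : Fin 7 → TangentSpace (𝓡 7) y := fun p => ∑ i, dH p i • f i y
  have hD : ∀ p s, (inner ℝ (D p) (e s y) : ℝ) = B p s := fun p s => by
    simp only [D, B, H, sum_inner, real_inner_smul_left]
  have hexp : ∀ z ∈ U', ∀ p, e p z = ∑ i, H p i z • f i z := fun z hz p => by
    conv_lhs => rw [← hf.sum_inner_smul hz (e p z)]
    exact Finset.sum_congr rfl fun i _ => by rw [real_inner_comm]
  have hort : ∀ z ∈ U ∩ U', ∀ p q, ∑ i, H p i z * H q i z = if p = q then 1 else 0 := by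
    intro z hz p q
    rw [← he.inner_eq hz.1 p q, hf.inner_eq_sum hz.2]
    exact Finset.sum_congr rfl fun i _ => by
      simp only [H]; rw [real_inner_comm (f i z), real_inner_comm (f i z)]
  have hnhds : U ∩ U' ∈ 𝓝 y := Filter.inter_mem (he.mem_nhds hy) (hf.mem_nhds hy')
  have hskew : ∀ p q, B q p = -B p q := by
    intro p q
    have h1 : (fun z => ∑ i, H p i z * H q i z) =ᶠ[𝓝 y] fun _ => if p = q then 1 else 0 := by
      filter_upwards [hnhds] with z hz
      exact hort z hz p q
    have h2 := congrArg (fun L => L v) (mvfderiv_eq_zero_of_eventuallyEq_const (I := 𝓡 7) h1)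
    simp only [_root_.zero_apply] at h2
    rw [mvfderiv_sum_mul (hH p) (hH q), Finset.sum_add_distrib] at h2
    simp only [B, dH]
    have h3 : ∑ i, mvfderiv (𝓡 7) (H q i) y v * H p i y =
        ∑ i, H p i y * mvfderiv (𝓡 7) (H q i) y v :=
      Finset.sum_congr rfl fun i _ => mul_comm _ _
    have h4 : ∑ i, mvfderiv (𝓡 7) (H p i) y v * H q i y =
        ∑ i, H q i y * mvfderiv (𝓡 7) (H p i) y v :=
      Finset.sum_congr rfl fun i _ => mul_comm _ _
    linarith
  have hform : ∀ (c d g : Fin 7 → ℝ), G.form y (∑ i, c i • f i y) (∑ i, d i • f i y)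
      (∑ i, g i • f i y) = ∑ i, c i * ∑ j, d j * ∑ k, g k * (eps i j k : ℝ) := by
    intro c d g
    rw [trilinear_sum_smul]
    simp only [h'.form_eq y hy']
  -- Differentiating `φ(e_p, e_q, e_r) = ε_pqr` expanded in the frame `f` puts `B` in `𝔤₂`.
  have hstab : ∀ p q r, G.form y (D p) (e q y) (e r y) + G.form y (e p y) (D q) (e r y)
      + G.form y (e p y) (e q y) (D r) = 0 := by
    intro p q r
    have h1 : (fun z => ∑ i, H p i z * ∑ j, H q j z * ∑ k, H r k z * (eps i j k : ℝ)) =ᶠ[𝓝 y]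
        fun _ => (eps p q r : ℝ) := by
      filter_upwards [hnhds] with z hz
      rw [← h.form_eq z hz.1 p q r, hexp z hz.2 p, hexp z hz.2 q, hexp z hz.2 r,
        trilinear_sum_smul]
      simp only [h'.form_eq z hz.2]
    have h2 := congrArg (fun L => L v) (mvfderiv_eq_zero_of_eventuallyEq_const (I := 𝓡 7) h1)
    simp only [_root_.zero_apply] at h2
    have hc : ∀ c : ℝ, MDifferentiableAt (𝓡 7) 𝓘(ℝ, ℝ) (fun _ : M => c) y :=
      fun c => mdifferentiableAt_const
    have hsum : ∀ {a b : Fin 7 → M → ℝ}, (∀ i, MDifferentiableAt (𝓡 7) 𝓘(ℝ, ℝ) (a i) y) →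
        (∀ i, MDifferentiableAt (𝓡 7) 𝓘(ℝ, ℝ) (b i) y) →
        MDifferentiableAt (𝓡 7) 𝓘(ℝ, ℝ) (fun z => ∑ i, a i z * b i z) y := fun {a b} ha hb => by
      have := MDifferentiableAt.sum (t := Finset.univ) (f := fun i z => a i z * b i z)
        fun i _ => (ha i).mul (hb i)
      have hab : (fun z => ∑ i, a i z * b i z) = ∑ i, fun z => a i z * b i z := by
        funext z; rw [Finset.sum_apply]
      rw [hab]
      exact this
    rw [mvfderiv_sum_mul (hH p) fun i => hsum (hH q) fun j => hsum (hH r) fun k => hc _] at h2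
    simp only [fun i => mvfderiv_sum_mul (I := 𝓡 7) (hH q)
      (fun j => hsum (hH r) fun k => hc (eps i j k : ℝ)) v,
      fun i j => mvfderiv_sum_mul (I := 𝓡 7) (hH r) (fun k => hc (eps i j k : ℝ)) v,
      mvfderiv_const, _root_.zero_apply, mul_zero, zero_add] at h2
    rw [hexp y hy' p, hexp y hy' q, hexp y hy' r, hform, hform, hform, ← h2]
    simp only [Finset.mul_sum, Finset.sum_mul, mul_add, Finset.sum_add_distrib, dH]
    simp only [mul_comm, mul_left_comm]
    ring
  have hg2 : ∀ m, ∑ p, ∑ q, (eps p q m : ℝ) * B q p = 0 := by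
    intro m
    have hmem : (WithLp.toLp 2 (fun p : Fin 7 × Fin 7 => B p.2 p.1) : MatSpace) ∈ g2 := by
      refine ⟨fun i j => hskew j i, fun i j k => ?_⟩
      have h1 := hstab i j k
      rw [form_frame_left h hU hy, form_frame_middle h hU hy, form_frame_right h hU hy] at h1
      simp only [hD] at h1
      simp only [Finset.sum_add_distrib]
      exact h1
    exact sum_eps_mul_of_mem_g2 hmem m
  have hcov : ∀ l q, (inner ℝ (leviCivita (𝓡 7) M (f l) y v) (e q y) : ℝ) =
      dH q l + ∑ r, H r l y * connectionMatrix e y v q r := fun l q =>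
    he.inner_leviCivita_frame hy (hf.mdifferentiableAt hy' l) v q
  have hcomp : ∀ m, (inner ℝ (∑ l, G.cross y (f l y) (leviCivita (𝓡 7) M (f l) y v)) (e m y) : ℝ) =
      inner ℝ (∑ l, G.cross y (e l y) (leviCivita (𝓡 7) M (e l) y v)) (e m y) := by
    intro m
    rw [inner_sum_cross h hU hy, trace_crossMatrix_mul, sum_inner]
    have h1 : ∀ l, (inner ℝ (G.cross y (f l y) (leviCivita (𝓡 7) M (f l) y v)) (e m y) : ℝ) =
        ∑ p, ∑ q, ((eps p q m : ℝ) * (dH q l * H p l y)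
        + ∑ r, (eps p q m : ℝ) * (connectionMatrix e y v q r * (H p l y * H r l y))) := by
      intro l
      rw [inner_cross]
      conv_lhs => rw [← he.sum_inner_smul hy (f l y)]
      simp only [map_sum, map_smul, LinearMap.sum_apply, LinearMap.smul_apply, smul_eq_mul,
        form_frame_middle h hU hy, hcov]
      refine Finset.sum_congr rfl fun p _ => ?_
      rw [Finset.mul_sum]
      refine Finset.sum_congr rfl fun q _ => ?_
      have h2 : ∑ r, (eps p q m : ℝ) * (connectionMatrix e y v q r * (H p l y * H r l y)) =
          H p l y * (eps p q m : ℝ) * ∑ r, H r l y * connectionMatrix e y v q r := by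
        rw [Finset.mul_sum]
        exact Finset.sum_congr rfl fun r _ => by ring
      rw [h2]
      simp only [H]
      ring
    have h2 : ∀ p q, ∑ l, ((eps p q m : ℝ) * (dH q l * H p l y)
        + ∑ r, (eps p q m : ℝ) * (connectionMatrix e y v q r * (H p l y * H r l y))) =
        (eps p q m : ℝ) * B q p + (eps p q m : ℝ) * connectionMatrix e y v q p := by
      intro p q
      rw [Finset.sum_add_distrib, ← Finset.mul_sum, Finset.sum_comm]
      simp only [← Finset.mul_sum, hort y ⟨hy, hy'⟩]
      simp [B]
    simp only [h1]
    rw [Finset.sum_comm, Finset.sum_congr rfl fun p _ => Finset.sum_comm]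
    simp only [h2, Finset.sum_add_distrib]
    rw [hg2, zero_add, Finset.sum_comm]
    simp only [← Finset.sum_neg_distrib]
    refine Finset.sum_congr rfl fun p _ => Finset.sum_congr rfl fun q _ => ?_
    rw [eps_swap p q]; push_cast; ring
  rw [← he.sum_inner_smul hy (∑ l, G.cross y (f l y) (leviCivita (𝓡 7) M (f l) y v)),
    ← he.sum_inner_smul hy (∑ l, G.cross y (e l y) (leviCivita (𝓡 7) M (e l) y v))]
  simp only [hcomp]

end G2Structure
end AdaptedFrames

/-! ### The torsion in an adapted frame and the scalar curvature -/

section TorsionMatrix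

variable {M : Type*} [TopologicalSpace M] [ChartedSpace (EuclideanSpace ℝ (Fin 7)) M]
  [IsManifold (𝓡 7) ∞ M] [RiemannianBundle (fun x : M => TangentSpace (𝓡 7) x)]

/-- The matrix of an endomorphism of the tangent space at `y` in the frame `e`, with entries
`g(α e_a, e_n)`. -/
noncomputable def frameMatrix (e : Fin 7 → Π x : M, TangentSpace (𝓡 7) x) (y : M)
    (α : Module.End ℝ (TangentSpace (𝓡 7) y)) : Matrix (Fin 7) (Fin 7) ℝ :=
  Matrix.of fun n a => inner ℝ (α (e a y)) (e n y)

theorem frameMatrix_apply (e : Fin 7 → Π x : M, TangentSpace (𝓡 7) x) (y : M)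
    (α : Module.End ℝ (TangentSpace (𝓡 7) y)) (n a : Fin 7) :
    frameMatrix e y α n a = inner ℝ (α (e a y)) (e n y) := rfl

theorem toMatrix_eq_frameMatrix {e : Fin 7 → Π x : M, TangentSpace (𝓡 7) x} {y : M}
    {b : OrthonormalBasis (Fin 7) ℝ (TangentSpace (𝓡 7) y)} (hb : ∀ i, b i = e i y)
    (α : Module.End ℝ (TangentSpace (𝓡 7) y)) :
    LinearMap.toMatrix b.toBasis b.toBasis α = frameMatrix e y α := by
  ext n a
  rw [LinearMap.toMatrix_apply, frameMatrix_apply, OrthonormalBasis.coe_toBasis_repr_apply,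
    OrthonormalBasis.repr_apply_apply, OrthonormalBasis.coe_toBasis, hb, hb, real_inner_comm]

/-- Newton's identity for `σ_2`. -/
theorem sigmaTwo_eq {e : Fin 7 → Π x : M, TangentSpace (𝓡 7) x} {y : M}
    {b : OrthonormalBasis (Fin 7) ℝ (TangentSpace (𝓡 7) y)} (hb : ∀ i, b i = e i y)
    (α : Module.End ℝ (TangentSpace (𝓡 7) y)) :
    2 * sigmaTwo α = (frameMatrix e y α).trace ^ 2
      - (frameMatrix e y α * frameMatrix e y α).trace := by
  rw [← Matrix.two_mul_charpoly_coeff_card_sub_two _ (by simp), ← toMatrix_eq_frameMatrix hb,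
    LinearMap.charpoly_toMatrix]
  rfl

variable [IsContMDiffRiemannianBundle (𝓡 7) ∞ (EuclideanSpace ℝ (Fin 7))
  (fun x : M => TangentSpace (𝓡 7) x)]

theorem mvfderiv_sum_const_mul {κ : Type} [Fintype κ] (c : κ → ℝ) {g : κ → M → ℝ} {y : M}
    (hg : ∀ i, MDifferentiableAt (𝓡 7) 𝓘(ℝ, ℝ) (g i) y) (v : TangentSpace (𝓡 7) y) :
    mvfderiv (𝓡 7) (fun z => ∑ i, c i * g i z) y v = ∑ i, c i * mvfderiv (𝓡 7) (g i) y v := by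
  have hc : ∀ i, MDifferentiableAt (𝓡 7) 𝓘(ℝ, ℝ) (fun _ : M => c i) y :=
    fun i => mdifferentiableAt_const
  rw [mvfderiv_sum (f := fun i z => c i * g i z) Finset.univ fun i _ => (hc i).mul (hg i)]
  simp only [_root_.sum_apply]
  refine Finset.sum_congr rfl fun i _ => ?_
  have := mvfderiv_fun_mul (hc i) (hg i)
  change mvfderiv (𝓡 7) (fun z => c i * g i z) y v = _
  rw [this]
  simp [mvfderiv_const]

namespace G2Structure

variable {G : G2Structure M} {e : Fin 7 → Π x : M, TangentSpace (𝓡 7) x} {U : Set M}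

/-- In any adapted frame `6 g(T v, e_m)` is the contraction of the connection matrix `ω(v)` with the
standard 3-form. -/
theorem trace_crossMatrix_mul_connectionMatrix (h : IsAdaptedFrameOn G.form e U) (hU : IsOpen U)
    {y : M} (hy : y ∈ U) (v : TangentSpace (𝓡 7) y) (m : Fin 7) :
    (crossMatrix m * connectionMatrix e y v).trace =
      6 * (inner ℝ (G.torsionEndomorphism y v) (e m y) : ℝ) := by
  obtain ⟨U', hU', hy', hF⟩ := G.frame_spec y
  have hFo := hF.isOrthonormalFrameOn hU'
  let F := G.frame y
  let t : Fin 7 → ℝ := fun k => inner ℝ (G.torsionEndomorphism y v) (F k y)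
  let c : Fin 7 → ℝ := fun k =>
    (1 / 6 : ℝ) * ∑ i, ∑ j, (eps i j k : ℝ) * G.connectionForm y v (i, j)
  have h1 : ∀ i j, -epsVec c (i, j) = epsVec t (i, j) := by
    intro i j
    have h2 := congrArg (fun w => (inner ℝ w (F i y) : ℝ)) (G.intrinsicTorsion_eq y v (F j y))
    simp only [inner_cross] at h2
    rw [form_frame_middle hF hU' hy'] at h2
    rw [intrinsicTorsion, starProjection_g2Perp, LinearMap.neg_apply, inner_neg_left] at h2
    have h3 : (inner ℝ (G.endOfMatrix y (epsVec c) (F j y)) (F i y) : ℝ) = epsVec c (i, j) := by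
      simp only [endOfMatrix, LinearMap.sum_apply, LinearMap.smul_apply,
        LinearMap.smulRight_apply, ContinuousLinearMap.coe_coe, innerSL_apply_apply, sum_inner,
        real_inner_smul_left, F, hFo.inner_eq hy']
      simp
    rw [h3] at h2
    rw [h2]
    simp only [epsVec]
    refine Finset.sum_congr rfl fun k _ => ?_
    rw [← eps_cyclic i j k, mul_comm]
  have h4 : ∀ k, c k = -t k := by
    intro k
    have h5 := sum_eps_mul_epsVec c k
    have h6 := sum_eps_mul_epsVec t k
    simp only [← h1, mul_neg, Finset.sum_neg_distrib, h5] at h6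
    linarith
  have h7 : ∑ l, G.cross y (F l y) (leviCivita (𝓡 7) M (F l) y v) =
      (6 : ℝ) • G.torsionEndomorphism y v := by
    rw [← hFo.sum_inner_smul hy' (∑ l, G.cross y (F l y) (leviCivita (𝓡 7) M (F l) y v)),
      ← hFo.sum_inner_smul hy' ((6 : ℝ) • G.torsionEndomorphism y v)]
    refine Finset.sum_congr rfl fun k _ => ?_
    congr 1
    rw [inner_sum_cross hF hU' hy', trace_crossMatrix_mul, real_inner_smul_left]
    have h8 := h4 k
    change (1 / 6 : ℝ) * ∑ i, ∑ j, (eps i j k : ℝ) * connectionMatrix F y v i j = -t k at h8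
    change _ = 6 * t k
    linarith
  rw [← inner_sum_cross h hU hy, ← sum_cross_frame_eq h hU hF hU' hy hy', h7, real_inner_smul_left]

/-- The vector `∑_i e_i × α(e_i)` may be computed in any adapted frame. -/
theorem inner_characteristicVectorOf (h : IsAdaptedFrameOn G.form e U) (hU : IsOpen U) {y : M}
    (hy : y ∈ U) (α : Module.End ℝ (TangentSpace (𝓡 7) y)) (m : Fin 7) :
    (inner ℝ (G.characteristicVectorOf y α) (e m y) : ℝ) =
      (crossMatrix m * frameMatrix e y α).trace := by
  obtain ⟨b, hb⟩ := (h.isOrthonormalFrameOn hU).exists_orthonormalBasis hy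
  have h1 : G.characteristicVectorOf y α = ∑ i, G.cross y (e i y) (α (e i y)) := by
    have := sum_bilinear_orthonormalBasis (stdOrthonormalBasis ℝ (TangentSpace (𝓡 7) y)) b
      ((G.cross y).compl₂ α)
    simp only [LinearMap.compl₂_apply, hb] at this
    exact this
  rw [h1, sum_inner, trace_crossMatrix_mul, Finset.sum_comm, ← Finset.sum_neg_distrib]
  refine Finset.sum_congr rfl fun a _ => ?_
  rw [inner_cross, form_frame_middle h hU hy, ← Finset.sum_neg_distrib]
  refine Finset.sum_congr rfl fun n _ => ?_
  rw [frameMatrix_apply, eps_swap n a]; push_cast; ring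

theorem characteristicVector_eq (G : G2Structure M) (y : M) :
    G.characteristicVector y = G.characteristicVectorOf y (G.torsionEndomorphism y) :=
  Finset.sum_congr rfl fun _ _ => G.intrinsicTorsion_eq y _ _

/-- The invariant `i_0` may be computed in any adapted frame. -/
theorem iZero_eq (h : IsAdaptedFrameOn G.form e U) (hU : IsOpen U) {y : M} (hy : y ∈ U)
    (α : Module.End ℝ (TangentSpace (𝓡 7) y)) :
    G.iZero y α = crossForm (frameMatrix e y α) := by
  obtain ⟨b, hb⟩ := (h.isOrthonormalFrameOn hU).exists_orthonormalBasis hy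
  let s := stdOrthonormalBasis ℝ (TangentSpace (𝓡 7) y)
  have h1 : G.iZero y α = ∑ i, ∑ j, (inner ℝ (G.cross y (α (s i)) (α (b j)))
      (G.cross y (s i) (b j)) : ℝ) := Finset.sum_congr rfl fun i _ =>
    sum_bilinear_orthonormalBasis s b ((innerₗ (TangentSpace (𝓡 7) y)).compl₁₂
      ((G.cross y (α (s i))).comp α) (G.cross y (s i)))
  have h2 : ∀ j, ∑ i, (inner ℝ (G.cross y (α (s i)) (α (b j))) (G.cross y (s i) (b j)) : ℝ) =
      ∑ i, (inner ℝ (G.cross y (α (b i)) (α (b j))) (G.cross y (b i) (b j)) : ℝ) := fun j =>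
    sum_bilinear_orthonormalBasis s b ((innerₗ (TangentSpace (𝓡 7) y)).compl₁₂
      (((G.cross y).flip (α (b j))).comp α) ((G.cross y).flip (b j)))
  rw [h1, Finset.sum_comm, Finset.sum_congr rfl fun j _ => h2 j, Finset.sum_comm, crossForm]
  refine Finset.sum_congr rfl fun i _ => Finset.sum_congr rfl fun j _ => ?_
  rw [inner_cross, hb, hb, form_eq_sum h hU hy]
  refine Finset.sum_congr rfl fun n _ => ?_
  rw [Finset.mul_sum]
  refine Finset.sum_congr rfl fun q _ => ?_
  rw [← mul_assoc]
  simp only [inner_cross, h.form_eq y hy, frameMatrix_apply]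
  congr 1
  exact Finset.sum_congr rfl fun k _ => mul_comm _ _

/-- If the characteristic vector field vanishes, the scalar curvature is a quadratic expression in
the intrinsic torsion: the derivative terms form the divergence of the characteristic vector
field. -/
theorem scalarCurvature_eq_of_characteristicVector_eq_zero (G : G2Structure M)
    (hχ : ∀ y, G.characteristicVector y = 0) (x : M) :
    scalarCurvature (𝓡 7) x = -9 * G.iZero x (G.torsionEndomorphism x)
      + 36 * sigmaTwo (G.torsionEndomorphism x) := by
  obtain ⟨U, hU, hx, h⟩ := G.frame_spec x
  have ho := h.isOrthonormalFrameOn hU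
  obtain ⟨b, hb⟩ := ho.exists_orthonormalBasis hx
  let e := G.frame x
  have hw : ∀ y ∈ U, ∀ m,
      (crossMatrix m * frameMatrix e y (G.torsionEndomorphism y)).trace = 0 := by
    intro y hy m
    rw [← inner_characteristicVectorOf h hU hy, ← characteristicVector_eq, hχ, inner_zero_left]
  have hT : ∀ y ∈ U, ∀ m a, (crossMatrix m * connectionMatrix e y (e a y)).trace =
      6 * frameMatrix e y (G.torsionEndomorphism y) m a := fun y hy m a =>
    trace_crossMatrix_mul_connectionMatrix h hU hy (e a y) m
  -- By cyclicity of `ε` this sum is `6 tr(E_a T)`, so it vanishes on all of `U`.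
  have hzero : ∀ a, ∀ y ∈ U, ∑ m, ∑ b, (eps a b m : ℝ) *
      (crossMatrix m * connectionMatrix e y (e b y)).trace = 0 := by
    intro a y hy
    have h1 := hw y hy a
    rw [trace_crossMatrix_mul, neg_eq_zero] at h1
    rw [← mul_zero (-6 : ℝ), ← h1, Finset.mul_sum]
    refine Finset.sum_congr rfl fun m _ => ?_
    rw [Finset.mul_sum]
    refine Finset.sum_congr rfl fun b _ => ?_
    rw [hT y hy, eps_cyclic a b m, eps_swap b m a]; push_cast; ring
  have hdiv : ∀ a, ∑ m, ∑ b, (eps a b m : ℝ) *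
      (crossMatrix m * connectionMatrixDeriv e x a b).trace = 0 := by
    intro a
    -- The identity `hzero` as a linear relation with constant coefficients, to be differentiated.
    let c : Fin 7 × Fin 7 × Fin 7 × Fin 7 → ℝ := fun t =>
      (eps a t.2.1 t.1 : ℝ) * crossMatrix t.1 t.2.2.1 t.2.2.2
    let g : Fin 7 × Fin 7 × Fin 7 × Fin 7 → M → ℝ := fun t y =>
      connectionMatrix e y (e t.2.1 y) t.2.2.2 t.2.2.1
    have hg : ∀ t, MDifferentiableAt (𝓡 7) 𝓘(ℝ, ℝ) (g t) x := fun t =>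
      mdifferentiableAt_of_smooth
        (ho.contMDiffAt_connectionMatrix_frame hx t.2.1 t.2.2.2 t.2.2.1)
    have h1 : (fun y => ∑ t, c t * g t y) =ᶠ[𝓝 x] fun _ => 0 := by
      filter_upwards [ho.mem_nhds hx] with y hy
      rw [← hzero a y hy]
      simp only [c, g, Fintype.sum_prod_type, Matrix.trace, Matrix.diag_apply, Matrix.mul_apply,
        Finset.mul_sum, mul_assoc]
    have h2 : mvfderiv (𝓡 7) (fun y => ∑ t, c t * g t y) x (e a x) = 0 := by
      rw [mvfderiv_eq_zero_of_eventuallyEq_const h1, _root_.zero_apply]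
    rw [mvfderiv_sum_const_mul c hg] at h2
    rw [← h2]
    simp only [c, g, Fintype.sum_prod_type, Matrix.trace, Matrix.diag_apply, Matrix.mul_apply,
      Finset.mul_sum, mul_assoc, connectionMatrixDeriv_apply]
  rw [ho.scalarCurvature_eq hx, sum_curvatureMatrix
    (fun a => ho.connectionMatrix_transpose hx (e a x)) (ho.connectionMatrixDeriv_transpose hx)
    (ho.bianchi hx) (hT x hx) (hw x hx) ?_, iZero_eq h hU hx, ← sigmaTwo_eq hb]
  · ring
  · rw [Finset.sum_comm]
    exact Finset.sum_eq_zero fun a _ => hdiv a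

end G2Structure
end TorsionMatrix

/-! ### The classes of endomorphisms and the characteristic vector -/

section Classes

variable {M : Type*} [TopologicalSpace M] [ChartedSpace (EuclideanSpace ℝ (Fin 7)) M]
  [IsManifold (𝓡 7) ∞ M] [RiemannianBundle (fun x : M => TangentSpace (𝓡 7) x)]
  [IsContMDiffRiemannianBundle (𝓡 7) ∞ (EuclideanSpace ℝ (Fin 7))
    (fun x : M => TangentSpace (𝓡 7) x)]

namespace G2Structure

variable (G : G2Structure M) {x : M}

theorem characteristicVectorOf_add (s t : Module.End ℝ (TangentSpace (𝓡 7) x)) :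
    G.characteristicVectorOf x (s + t) =
      G.characteristicVectorOf x s + G.characteristicVectorOf x t := by
  simp only [characteristicVectorOf, inducedTensor, LinearMap.add_apply, map_add,
    Finset.sum_add_distrib]

/-- The contraction of a symmetric matrix with the skew-symmetric `E_m` vanishes. -/
theorem characteristicVectorOf_eq_zero_of_symmetric {t : Module.End ℝ (TangentSpace (𝓡 7) x)}
    (ht : ∀ u v, inner ℝ (t u) v = (inner ℝ u (t v) : ℝ)) : G.characteristicVectorOf x t = 0 := by
  obtain ⟨U, hU, hx, h⟩ := G.frame_spec x
  have hA : (frameMatrix (G.frame x) x t)ᵀ = frameMatrix (G.frame x) x t := by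
    ext i j
    rw [Matrix.transpose_apply, frameMatrix_apply, frameMatrix_apply, ht, real_inner_comm]
  rw [← (h.isOrthonormalFrameOn hU).sum_inner_smul hx (G.characteristicVectorOf x t)]
  refine Finset.sum_eq_zero fun m _ => ?_
  have h1 : (crossMatrix m * frameMatrix (G.frame x) x t).trace =
      -(crossMatrix m * frameMatrix (G.frame x) x t).trace := by
    conv_lhs => rw [← Matrix.trace_transpose, Matrix.transpose_mul, hA, crossMatrix_transpose,
      Matrix.mul_neg, Matrix.trace_neg, Matrix.trace_mul_comm]
  rw [inner_characteristicVectorOf h hU hx, self_eq_neg.1 h1, zero_smul]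

theorem symmetric_of_mem_classOne {t : Module.End ℝ (TangentSpace (𝓡 7) x)} (ht : t ∈ classOne x)
    (u v : TangentSpace (𝓡 7) x) : inner ℝ (t u) v = (inner ℝ u (t v) : ℝ) := by
  obtain ⟨c, rfl⟩ := Submodule.mem_span_singleton.1 ht
  simp [real_inner_smul_left, real_inner_smul_right]

theorem characteristicVectorOf_eq_zero_of_mem_classTwo {t : Module.End ℝ (TangentSpace (𝓡 7) x)}
    (ht : t ∈ G.classTwo x) : G.characteristicVectorOf x t = 0 := by
  obtain ⟨U, hU, hx, h⟩ := G.frame_spec x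
  let a : MatSpace := WithLp.toLp 2 fun p => frameMatrix (G.frame x) x t p.1 p.2
  have ha : a ∈ g2 := by
    refine ⟨fun i j => ?_, fun i j k => ?_⟩
    · change inner ℝ (t (G.frame x i x)) (G.frame x j x) =
        -(inner ℝ (t (G.frame x j x)) (G.frame x i x) : ℝ)
      rw [ht.1, real_inner_comm]
    · have h1 := ht.2 (G.frame x i x) (G.frame x j x) (G.frame x k x)
      rw [form_frame_left h hU hx, form_frame_middle h hU hx, form_frame_right h hU hx] at h1
      simp only [Finset.sum_add_distrib]
      exact h1
  rw [← (h.isOrthonormalFrameOn hU).sum_inner_smul hx (G.characteristicVectorOf x t)]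
  refine Finset.sum_eq_zero fun m _ => ?_
  have h1 := sum_eps_mul_of_mem_g2 ha m
  rw [inner_characteristicVectorOf h hU hx, trace_crossMatrix_mul]
  simp only [a] at h1
  rw [h1, neg_zero, zero_smul]

/-- Skew-symmetric endomorphisms with vanishing characteristic vector stabilize the 3-form: the
characteristic vector determines the component orthogonal to the Lie algebra of `G_2`. -/
theorem mem_classTwo_of_characteristicVectorOf_eq_zero
    {t : Module.End ℝ (TangentSpace (𝓡 7) x)}
    (ht : ∀ u v, inner ℝ (t u) v = -(inner ℝ u (t v) : ℝ))
    (hχ : G.characteristicVectorOf x t = 0) : t ∈ G.classTwo x := by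
  obtain ⟨U, hU, hx, h⟩ := G.frame_spec x
  have ho := h.isOrthonormalFrameOn hU
  let a : MatSpace := WithLp.toLp 2 fun p => frameMatrix (G.frame x) x t p.1 p.2
  have ha : a ∈ g2 := by
    refine mem_g2_of_sum_eps_mul (fun i j => ?_) fun m => ?_
    · change inner ℝ (t (G.frame x i x)) (G.frame x j x) =
        -(inner ℝ (t (G.frame x j x)) (G.frame x i x) : ℝ)
      rw [ht, real_inner_comm]
    · have h1 := inner_characteristicVectorOf h hU hx t m
      rw [hχ, inner_zero_left, trace_crossMatrix_mul] at h1
      exact neg_eq_zero.1 h1.symm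
  let φ := (G.form x).comp t + (G.form x).compl₂ t + (G.form x).compr₂ (LinearMap.lcomp ℝ ℝ t)
  have hφ : ∀ i j k, φ (G.frame x i x) (G.frame x j x) (G.frame x k x) = 0 := by
    intro i j k
    change G.form x (t (G.frame x i x)) (G.frame x j x) (G.frame x k x)
      + G.form x (G.frame x i x) (t (G.frame x j x)) (G.frame x k x)
      + G.form x (G.frame x i x) (G.frame x j x) (t (G.frame x k x)) = 0
    rw [form_frame_left h hU hx, form_frame_middle h hU hx, form_frame_right h hU hx]
    have h1 := ha.2 i j k
    simp only [Finset.sum_add_distrib] at h1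
    exact h1
  refine ⟨ht, fun u v w => ?_⟩
  change φ u v w = 0
  rw [← ho.sum_inner_smul hx u, ← ho.sum_inner_smul hx v, ← ho.sum_inner_smul hx w,
    trilinear_sum_smul]
  simp [hφ]

theorem characteristicVectorOf_cross (Z : TangentSpace (𝓡 7) x) :
    G.characteristicVectorOf x ((G.cross x).flip Z) = (-6 : ℝ) • Z := by
  obtain ⟨U, hU, hx, h⟩ := G.frame_spec x
  have ho := h.isOrthonormalFrameOn hU
  rw [← ho.sum_inner_smul hx (G.characteristicVectorOf x ((G.cross x).flip Z)),
    ← ho.sum_inner_smul hx ((-6 : ℝ) • Z)]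
  refine Finset.sum_congr rfl fun m _ => ?_
  congr 1
  rw [inner_characteristicVectorOf h hU hx, trace_crossMatrix_mul, real_inner_smul_left]
  have h1 := sum_eps_mul_epsVec (fun k => inner ℝ Z (G.frame x k x)) m
  have h2 : ∀ n a, frameMatrix (G.frame x) x ((G.cross x).flip Z) n a =
      epsVec (fun k => inner ℝ Z (G.frame x k x)) (n, a) := by
    intro n a
    rw [frameMatrix_apply, LinearMap.flip_apply, inner_cross, form_frame_middle h hU hx]
    simp only [epsVec]
    refine Finset.sum_congr rfl fun k _ => ?_
    rw [eps_cyclic n a k, mul_comm]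
  simp only [h2, h1]
  ring

theorem trace_eq_zero_of_mem_classTwo {t : Module.End ℝ (TangentSpace (𝓡 7) x)}
    (ht : t ∈ G.classTwo x) : LinearMap.trace ℝ (TangentSpace (𝓡 7) x) t = 0 := by
  rw [LinearMap.trace_eq_sum_inner t (stdOrthonormalBasis ℝ (TangentSpace (𝓡 7) x))]
  refine Finset.sum_eq_zero fun i _ => ?_
  have h1 := ht.1 (stdOrthonormalBasis ℝ (TangentSpace (𝓡 7) x) i)
    (stdOrthonormalBasis ℝ (TangentSpace (𝓡 7) x) i)
  rw [real_inner_comm] at h1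
  linarith

theorem finrank_tangentSpace (x : M) : Module.finrank ℝ (TangentSpace (𝓡 7) x) = 7 :=
  finrank_euclideanSpace_fin (𝕜 := ℝ) (n := 7)

variable {G}

theorem IsDecompositionAt.eq_flip {t : Fin 4 → Module.End ℝ (TangentSpace (𝓡 7) x)}
    {Z : TangentSpace (𝓡 7) x} (h : G.IsDecompositionAt x t Z) : t 3 = (G.cross x).flip Z :=
  LinearMap.ext h.induced

theorem IsDecompositionAt.characteristicVectorOf_eq
    {t : Fin 4 → Module.End ℝ (TangentSpace (𝓡 7) x)} {Z : TangentSpace (𝓡 7) x}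
    (h : G.IsDecompositionAt x t Z) :
    G.characteristicVectorOf x (G.torsionEndomorphism x) = (-6 : ℝ) • Z := by
  rw [h.sum_eq, characteristicVectorOf_add, characteristicVectorOf_add, characteristicVectorOf_add,
    G.characteristicVectorOf_eq_zero_of_symmetric (symmetric_of_mem_classOne h.one),
    G.characteristicVectorOf_eq_zero_of_mem_classTwo h.two,
    G.characteristicVectorOf_eq_zero_of_symmetric h.three.1, h.eq_flip,
    characteristicVectorOf_cross, add_zero, add_zero, zero_add]

theorem IsDecompositionAt.unique {t t' : Fin 4 → Module.End ℝ (TangentSpace (𝓡 7) x)}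
    {Z Z' : TangentSpace (𝓡 7) x} (h : G.IsDecompositionAt x t Z)
    (h' : G.IsDecompositionAt x t' Z') : t = t' ∧ Z = Z' := by
  have hZ : Z = Z' := smul_right_injective _ (by norm_num : (-6 : ℝ) ≠ 0)
    (h.characteristicVectorOf_eq.symm.trans h'.characteristicVectorOf_eq)
  have h3 : t 3 = t' 3 := by rw [h.eq_flip, h'.eq_flip, hZ]
  have hsum : t 0 + t 1 + t 2 = t' 0 + t' 1 + t' 2 := by
    have h1 := h.sum_eq.symm.trans h'.sum_eq
    rw [h3] at h1
    exact add_right_cancel h1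
  have h0 : t 0 = t' 0 := by
    have h1 := congrArg (LinearMap.trace ℝ (TangentSpace (𝓡 7) x)) hsum
    simp only [map_add, G.trace_eq_zero_of_mem_classTwo h.two,
      G.trace_eq_zero_of_mem_classTwo h'.two, h.three.2, h'.three.2, add_zero] at h1
    obtain ⟨c, hc⟩ := Submodule.mem_span_singleton.1 h.one
    obtain ⟨c', hc'⟩ := Submodule.mem_span_singleton.1 h'.one
    rw [← hc, ← hc', map_smul, map_smul, LinearMap.trace_one, finrank_tangentSpace] at h1
    simp only [smul_eq_mul, Nat.cast_ofNat] at h1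
    rw [← hc, ← hc', mul_right_cancel₀ (by norm_num) h1]
  have h12 : t 1 + t 2 = t' 1 + t' 2 := by
    rw [h0, add_assoc, add_assoc] at hsum
    exact add_left_cancel hsum
  have h1 : t 1 = t' 1 := by
    -- The difference is both skew-symmetric and symmetric.
    have hs := (G.classTwo x).sub_mem h.two h'.two
    have hd : t 1 - t' 1 = t' 2 - t 2 := by
      rw [sub_eq_sub_iff_add_eq_add, h12, add_comm]
    have hy := (classThree x).sub_mem h'.three h.three
    rw [← hd] at hy
    refine sub_eq_zero.1 (LinearMap.ext fun u => ext_inner_right ℝ fun v => ?_)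
    have ha := hs.1 u v
    have hb := hy.1 u v
    rw [LinearMap.zero_apply, inner_zero_left]
    linarith
  have h2 : t 2 = t' 2 := by
    rw [h1] at h12
    exact add_left_cancel h12
  refine ⟨funext fun i => ?_, hZ⟩
  fin_cases i
  exacts [h0, h1, h2, h3]

variable (G)

theorem exists_isDecompositionAt (x : M) : ∃ t Z, G.IsDecompositionAt x t Z := by
  let T := G.torsionEndomorphism x
  let Z := (-(1 / 6) : ℝ) • G.characteristicVectorOf x T
  let t₄ := (G.cross x).flip Z
  let R := T - t₄
  let S := (1 / 2 : ℝ) • (R + R.adjoint)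
  let K := (1 / 2 : ℝ) • (R - R.adjoint)
  let c := LinearMap.trace ℝ (TangentSpace (𝓡 7) x) S / 7
  have hS : ∀ u v, inner ℝ (S u) v = (inner ℝ u (S v) : ℝ) := fun u v => by
    simp only [S, LinearMap.smul_apply, LinearMap.add_apply, real_inner_smul_left,
      real_inner_smul_right, inner_add_left, inner_add_right, LinearMap.adjoint_inner_left,
      LinearMap.adjoint_inner_right]
    ring
  have hK : ∀ u v, inner ℝ (K u) v = -(inner ℝ u (K v) : ℝ) := fun u v => by
    simp only [K, LinearMap.smul_apply, LinearMap.sub_apply, real_inner_smul_left,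
      real_inner_smul_right, inner_sub_left, inner_sub_right, LinearMap.adjoint_inner_left,
      LinearMap.adjoint_inner_right]
    ring
  have hR : R = K + S := by
    simp only [K, S]
    module
  have hT : T = R + t₄ := (sub_add_cancel T t₄).symm
  have hKχ : G.characteristicVectorOf x K = 0 := by
    have h1 : G.characteristicVectorOf x T = _ :=
      (congrArg (G.characteristicVectorOf x) hT).trans (G.characteristicVectorOf_add R t₄)
    rw [hR, characteristicVectorOf_add, G.characteristicVectorOf_eq_zero_of_symmetric hS,
      characteristicVectorOf_cross, smul_smul] at h1
    norm_num at h1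
    exact h1
  have h0 : c • (1 : Module.End ℝ (TangentSpace (𝓡 7) x)) ∈ classOne x :=
    Submodule.mem_span_singleton.2 ⟨c, rfl⟩
  refine ⟨![c • 1, K, S - c • 1, t₄], Z, h0,
    G.mem_classTwo_of_characteristicVectorOf_eq_zero hK hKχ, ⟨fun u v => ?_, ?_⟩, ⟨Z, rfl⟩, ?_,
    fun u => rfl⟩
  · change inner ℝ ((S - c • 1) u) v = (inner ℝ u ((S - c • 1) v) : ℝ)
    rw [LinearMap.sub_apply, LinearMap.sub_apply, inner_sub_left, inner_sub_right, hS,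
      symmetric_of_mem_classOne h0]
  · change LinearMap.trace ℝ (TangentSpace (𝓡 7) x) (S - c • 1) = 0
    have h1 : LinearMap.trace ℝ (TangentSpace (𝓡 7) x) (c • 1) = c * 7 := by
      rw [map_smul, LinearMap.trace_one, finrank_tangentSpace, smul_eq_mul, Nat.cast_ofNat]
    rw [map_sub, h1]
    exact sub_eq_zero.2 (div_mul_cancel₀ _ (by norm_num)).symm
  · change T = c • 1 + K + (S - c • 1) + t₄
    rw [hT, hR]
    abel

theorem characteristicVector_eq_zero (hG : G.IsOfTypeOneTwoThree) (x : M) :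
    G.characteristicVector x = 0 := by
  obtain ⟨s, hs, t₃, h₃, hT⟩ := Submodule.mem_sup.1 (hG x)
  obtain ⟨t₁, h₁, t₂, h₂, rfl⟩ := Submodule.mem_sup.1 hs
  rw [characteristicVector_eq, ← hT, characteristicVectorOf_add, characteristicVectorOf_add,
    G.characteristicVectorOf_eq_zero_of_symmetric (symmetric_of_mem_classOne h₁),
    G.characteristicVectorOf_eq_zero_of_mem_classTwo h₂,
    G.characteristicVectorOf_eq_zero_of_symmetric h₃.1, add_zero, add_zero]

end G2Structure
end Classes
end G2Geometry

theorem proposition4p4 {M : Type*} [TopologicalSpace M]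
    [ChartedSpace (EuclideanSpace ℝ (Fin 7)) M] [IsManifold (𝓡 7) ∞ M]
    [RiemannianBundle (fun x : M => TangentSpace (𝓡 7) x)]
    [IsContMDiffRiemannianBundle (𝓡 7) ∞ (EuclideanSpace ℝ (Fin 7))
      (fun x : M => TangentSpace (𝓡 7) x)]
    (G : G2Geometry.G2Structure M) :
    (G.IsOfTypeOneTwoThree → ∀ x : M,
      G.characteristicVector x = 0 ∧
      (1 / 6 : ℝ) * G2Geometry.scalarCurvature (𝓡 7) x =
        -(3 / 2 : ℝ) * G.iZero x (G.torsionEndomorphism x)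
          + 6 * G2Geometry.sigmaTwo (G.torsionEndomorphism x)) ∧
    (∀ x : M,
      (∃! p : (Fin 4 → Module.End ℝ (TangentSpace (𝓡 7) x)) × TangentSpace (𝓡 7) x,
        G.IsDecompositionAt x p.1 p.2) ∧
      ∀ (t : Fin 4 → Module.End ℝ (TangentSpace (𝓡 7) x)) (Z : TangentSpace (𝓡 7) x),
        G.IsDecompositionAt x t Z →
          G.characteristicVectorOf x (t 0) = 0 ∧
          G.characteristicVectorOf x (t 1) = 0 ∧
          G.characteristicVectorOf x (t 2) = 0 ∧
          G.characteristicVectorOf x (t 3) = (-6 : ℝ) • Z ∧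
          G.characteristicVector x = G.characteristicVectorOf x (t 3)) := by
  refine ⟨fun hG x => ⟨G.characteristicVector_eq_zero hG x, ?_⟩, fun x => ⟨?_, fun t Z h => ?_⟩⟩
  · rw [G.scalarCurvature_eq_of_characteristicVector_eq_zero (G.characteristicVector_eq_zero hG) x]
    ring
  · obtain ⟨t, Z, h⟩ := G.exists_isDecompositionAt x
    refine ⟨(t, Z), h, fun p hp => ?_⟩
    obtain ⟨h1, h2⟩ := G2Geometry.G2Structure.IsDecompositionAt.unique hp h
    exact Prod.ext h1 h2
  · have h3 : G.characteristicVectorOf x (t 3) = (-6 : ℝ) • Z := by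
      rw [h.eq_flip, G.characteristicVectorOf_cross]
    exact ⟨G.characteristicVectorOf_eq_zero_of_symmetric
        (G2Geometry.G2Structure.symmetric_of_mem_classOne h.one),
      G.characteristicVectorOf_eq_zero_of_mem_classTwo h.two,
      G.characteristicVectorOf_eq_zero_of_symmetric h.three.1, h3,
      by rw [G.characteristicVector_eq, h.characteristicVectorOf_eq, h3]⟩
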